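/- Let $\mathfrak h$ be a complex Hilbert space, $E$ a bounded self-adjoint operator on $\mathfrak h$, and $g\in C_c^\infty(\mathbb R;\mathbb C)$ with $\int_{\mathbb R} g(s)\,ds=1$. Put $\rho(t)=\int_{\mathbb R}\overline{g(s)}\,g(s+t)\,ds$, $\kappa_+=\int_0^\infty\rho(s)\,ds$, $\kappa_-=\int_{-\infty}^0\rho(s)\,ds$, and $g^{(k)}(t)=k\,g(kt)$ for real $k>0$. On $L^2(\mathbb R;\mathfrak h)$ let $$H^{(k)}f=i\,\partial f+g^{(k)}\,E\int_{\mathbb R}\overline{g^{(k)}(s)}\,f(s)\,ds,\qquad \mathrm{Dom}(H^{(k)})=W^{1,2}(\mathbb R;\mathfrak h).$$ Then $I+i\kappa_+E$ is invertible and $S=(I-i\kappa_-E)(I+i\kappa_+E)^{-1}$ is unitary. Let $$Hf=i\,\partial f,\qquad \mathrm{Dom}(H)=\{f\in W^{1,2}(\mathbb R\setminus\{0\};\mathfrak h): f(0^-)=S f(0^+)\},$$ where $\partial$ is the weak derivative on $\mathbb R\setminus\{0\}$. There are unique strongly continuous one-parameter unitary groups $U^{(k)}(t)=e^{-itH^{(k)}}$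 ($k>0$) and $U(t)=e^{-itH}$ on $L^2(\mathbb R;\mathfrak h)$ with Stone generators $H^{(k)}$ and $H$ respectively, and for every $0\le T<\infty$ $$\lim_{k\to\infty}\ \sup_{0\le t\le T}\big\|\big(U^{(k)}(t)-U(t)\big)f\big\|=0\qquad\text{for all } f\in L^2(\mathbb R;\mathfrak h).$$ -/

import Mathlib

open MeasureTheory Filter Topology Complex Set
open scoped ContDiff ENNReal

noncomputable section

namespace SingularLimit

variable {𝔥 : Type*} [NormedAddCommGroup 𝔥] [InnerProductSpace ℂ 𝔥]

variable (𝔥) in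
/-- The space `L²(ℝ; 𝔥)`. -/
abbrev L2 : Type _ := Lp 𝔥 2 (volume : Measure ℝ)

/-! ### Weak derivatives and Sobolev spaces -/

/-- `f'` is a weak derivative of `f` on the open set `X`: integration by parts holds against
every smooth test function with compact support contained in `X`. -/
def IsWeakDeriv (X : Set ℝ) (f f' : L2 𝔥) : Prop :=
  ∀ φ : ℝ → ℝ, ContDiff ℝ ∞ φ → HasCompactSupport φ → tsupport φ ⊆ X →
    ∫ x, deriv φ x • f x = - ∫ x, φ x • f' x

theorem integrable_test_smul {φ : ℝ → ℝ} (hφ : Continuous φ) (hc : HasCompactSupport φ)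
    (f : L2 𝔥) : Integrable (fun x => φ x • f x) := by
  have h := (Lp.memLp f).locallyIntegrable (by norm_num)
  exact h.integrable_smul_left_of_hasCompactSupport hφ hc

theorem IsWeakDeriv.add {X : Set ℝ} {f f' g g' : L2 𝔥} (hf : IsWeakDeriv X f f')
    (hg : IsWeakDeriv X g g') : IsWeakDeriv X (f + g) (f' + g') := by
  intro φ h1 h2 h3
  have hd : Continuous (deriv φ) := h1.continuous_deriv (by simp)
  have e1 : ∫ x, deriv φ x • (f + g : L2 𝔥) x = ∫ x, (deriv φ x • f x + deriv φ x • g x) := by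
    apply integral_congr_ae
    filter_upwards [Lp.coeFn_add f g] with x hx
    rw [hx, Pi.add_apply, smul_add]
  have e2 : ∫ x, φ x • (f' + g' : L2 𝔥) x = ∫ x, (φ x • f' x + φ x • g' x) := by
    apply integral_congr_ae
    filter_upwards [Lp.coeFn_add f' g'] with x hx
    rw [hx, Pi.add_apply, smul_add]
  rw [e1, e2, integral_add (integrable_test_smul hd h2.deriv f)
    (integrable_test_smul hd h2.deriv g), integral_add
    (integrable_test_smul h1.continuous h2 f') (integrable_test_smul h1.continuous h2 g'),
    hf φ h1 h2 h3, hg φ h1 h2 h3, neg_add]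

theorem IsWeakDeriv.smul {X : Set ℝ} {f f' : L2 𝔥} (c : ℂ) (hf : IsWeakDeriv X f f') :
    IsWeakDeriv X (c • f) (c • f') := by
  intro φ h1 h2 h3
  have e1 : ∫ x, deriv φ x • (c • f : L2 𝔥) x = ∫ x, c • (deriv φ x • f x) := by
    apply integral_congr_ae
    filter_upwards [Lp.coeFn_smul c f] with x hx
    rw [hx, Pi.smul_apply, smul_comm]
  have e2 : ∫ x, φ x • (c • f' : L2 𝔥) x = ∫ x, c • (φ x • f' x) := by
    apply integral_congr_ae
    filter_upwards [Lp.coeFn_smul c f'] with x hx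
    rw [hx, Pi.smul_apply, smul_comm]
  rw [e1, e2, integral_smul, integral_smul, hf φ h1 h2 h3, smul_neg]

theorem IsWeakDeriv.zero (X : Set ℝ) : IsWeakDeriv X (0 : L2 𝔥) 0 := by
  intro φ _ _ _
  have h : (⇑(0 : L2 𝔥)) =ᵐ[volume] 0 := Lp.coeFn_zero 𝔥 2 volume
  have e1 : ∫ x, deriv φ x • (0 : L2 𝔥) x = ∫ _ : ℝ, (0 : 𝔥) := by
    apply integral_congr_ae
    filter_upwards [h] with x hx
    rw [hx, Pi.zero_apply, smul_zero]
  have e2 : ∫ x, φ x • (0 : L2 𝔥) x = ∫ _ : ℝ, (0 : 𝔥) := by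
    apply integral_congr_ae
    filter_upwards [h] with x hx
    rw [hx, Pi.zero_apply, smul_zero]
  rw [e1, e2]
  simp

/-- The Sobolev space `W^{1,2}(X; 𝔥)` of an open set `X` with null complement, as a subspace of
`L²(X; 𝔥) = L²(ℝ; 𝔥)`: the functions that have a square integrable weak derivative on `X`. -/
def W12 (X : Set ℝ) : Submodule ℂ (L2 𝔥) where
  carrier := {f | ∃ f' : L2 𝔥, IsWeakDeriv X f f'}
  add_mem' := by
    rintro f g ⟨f', hf⟩ ⟨g', hg⟩
    exact ⟨_, hf.add hg⟩
  zero_mem' := ⟨0, IsWeakDeriv.zero X⟩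
  smul_mem' := by
    rintro c f ⟨f', hf⟩
    exact ⟨_, hf.smul c⟩

theorem IsWeakDeriv.unique [CompleteSpace 𝔥] {X : Set ℝ} (hX : IsOpen X)
    (hX0 : volume Xᶜ = 0) {f f' f'' : L2 𝔥} (h' : IsWeakDeriv X f f')
    (h'' : IsWeakDeriv X f f'') : f' = f'' := by
  have key : ∀ᵐ x ∂(volume : Measure ℝ), x ∈ X → (f' x - f'' x) = 0 := by
    refine hX.ae_eq_zero_of_integral_contDiff_smul_eq_zero ?_ ?_
    · exact ((((Lp.memLp f').locallyIntegrable (by norm_num)).sub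
        ((Lp.memLp f'').locallyIntegrable (by norm_num))).locallyIntegrableOn X)
    · intro φ h1 h2 h3
      have e := (h' φ h1 h2 h3).symm.trans (h'' φ h1 h2 h3)
      simp only [smul_sub]
      rw [integral_sub (integrable_test_smul h1.continuous h2 f')
        (integrable_test_smul h1.continuous h2 f''), neg_inj.mp e, sub_self]
  have hmem : ∀ᵐ x ∂(volume : Measure ℝ), x ∈ X := by
    rw [ae_iff]; exact hX0
  apply Lp.ext
  filter_upwards [key, hmem] with x h1 h2
  exact sub_eq_zero.mp (h1 h2)

/-- The weak derivative `∂` as an unbounded operator in `L²(ℝ; 𝔥)` with domain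
`W^{1,2}(X; 𝔥)`. -/
def weakDeriv [CompleteSpace 𝔥] (X : Set ℝ) (hX : IsOpen X) (hX0 : volume Xᶜ = 0) :
    L2 𝔥 →ₗ.[ℂ] L2 𝔥 where
  domain := W12 X
  toFun :=
    { toFun := fun f => Classical.choose f.2
      map_add' := fun f g => IsWeakDeriv.unique hX hX0 (Classical.choose_spec (f + g).2)
        ((Classical.choose_spec f.2).add (Classical.choose_spec g.2))
      map_smul' := fun c f => IsWeakDeriv.unique hX hX0 (Classical.choose_spec (c • f).2)
        ((Classical.choose_spec f.2).smul c) }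

/-- The weak derivative on the whole line, with domain `W^{1,2}(ℝ; 𝔥)`. -/
def derivLine [CompleteSpace 𝔥] : L2 𝔥 →ₗ.[ℂ] L2 𝔥 :=
  weakDeriv Set.univ isOpen_univ (by simp)

/-- The weak derivative on the punctured line, with domain `W^{1,2}(ℝ ∖ {0}; 𝔥)`. -/
def derivPunctured [CompleteSpace 𝔥] : L2 𝔥 →ₗ.[ℂ] L2 𝔥 :=
  weakDeriv {0}ᶜ isOpen_compl_singleton (by simp)

/-! ### The approximating Hamiltonians -/

/-- The rescaled function `g^{(k)}(t) = k g(k t)`. -/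
def scaled (g : ℝ → ℂ) (k : ℝ) : ℝ → ℂ := fun t => (k : ℂ) * g (k * t)

theorem memLp_scaled {g : ℝ → ℂ} (hg : ContDiff ℝ ∞ g) (hc : HasCompactSupport g) (k : ℝ) :
    MemLp (scaled g k) 2 (volume : Measure ℝ) := by
  rcases eq_or_ne k 0 with rfl | hk
  · have : scaled g 0 = 0 := by
      funext t
      simp [scaled]
    rw [this]
    exact MemLp.zero
  · have hcont : Continuous (scaled g k) := by
      have := hg.continuous
      unfold scaled
      fun_prop
    have h1 : HasCompactSupport (fun t => g (k * t)) :=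
      hc.comp_homeomorph (Homeomorph.mulLeft₀ k hk)
    have h2 : HasCompactSupport (scaled g k) := h1.mul_left
    exact hcont.memLp_of_hasCompactSupport h2

/-- The function `g^{(k)}` as an element of `L²(ℝ; ℂ)`. -/
def scaledL2 (g : ℝ → ℂ) (hg : ContDiff ℝ ∞ g) (hc : HasCompactSupport g) (k : ℝ) : L2 ℂ :=
  (memLp_scaled hg hc k).toLp (scaled g k)

theorem integrable_bra (γ : L2 ℂ) (f : L2 𝔥) :
    Integrable (fun s => (starRingEnd ℂ) (γ s) • f s) := by
  have h1 : MemLp (fun s => (starRingEnd ℂ) (γ s)) 2 (volume : Measure ℝ) := (Lp.memLp γ).star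
  exact memLp_one_iff_integrable.mp ((Lp.memLp f).smul h1)

/-- The map `⟨γ| : L²(ℝ; 𝔥) → 𝔥`, `f ↦ ∫ γ(s)^* f(s) ds`. -/
def bra (γ : L2 ℂ) : L2 𝔥 →ₗ[ℂ] 𝔥 where
  toFun f := ∫ s, (starRingEnd ℂ) (γ s) • f s
  map_add' f g := by
    rw [← integral_add (integrable_bra γ f) (integrable_bra γ g)]
    apply integral_congr_ae
    filter_upwards [Lp.coeFn_add f g] with x hx
    rw [hx, Pi.add_apply, smul_add]
  map_smul' c f := by
    rw [RingHom.id_apply, ← integral_smul]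
    apply integral_congr_ae
    filter_upwards [Lp.coeFn_smul c f] with x hx
    rw [hx, Pi.smul_apply, smul_comm]

theorem memLp_ket (γ : L2 ℂ) (v : 𝔥) : MemLp (fun t => γ t • v) 2 (volume : Measure ℝ) :=
  (ContinuousLinearMap.toSpanSingleton ℂ v).comp_memLp γ

/-- The map `|γ⟩ : 𝔥 → L²(ℝ; 𝔥)`, `v ↦ (t ↦ γ(t) v)`. -/
def ket (γ : L2 ℂ) : 𝔥 →ₗ[ℂ] L2 𝔥 where
  toFun v := (memLp_ket γ v).toLp (fun t => γ t • v)
  map_add' v w := by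
    rw [← MemLp.toLp_add]
    congr 1
    funext t
    exact smul_add _ _ _
  map_smul' c v := by
    rw [RingHom.id_apply, ← MemLp.toLp_const_smul]
    congr 1
    funext t
    exact smul_comm _ _ _

/-- The operator `i ∂ + E |γ⟩⟨γ|` with domain `W^{1,2}(ℝ; 𝔥)`. -/
def perturbedHamiltonian [CompleteSpace 𝔥] (E : 𝔥 →L[ℂ] 𝔥) (γ : L2 ℂ) : L2 𝔥 →ₗ.[ℂ] L2 𝔥 where
  domain := (derivLine (𝔥 := 𝔥)).domain
  toFun := I • (derivLine (𝔥 := 𝔥)).toFun +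
    (ket γ ∘ₗ (E : 𝔥 →ₗ[ℂ] 𝔥) ∘ₗ bra γ) ∘ₗ (derivLine (𝔥 := 𝔥)).domain.subtype

/-! ### The limit Hamiltonian -/

/-- The autocorrelation function `ρ(t) = ∫ g(s)^* g(s + t) ds`. -/
def rho (g : ℝ → ℂ) (t : ℝ) : ℂ := ∫ s : ℝ, (starRingEnd ℂ) (g s) * g (s + t)

/-- `κ₊ = ∫_0^∞ ρ(s) ds`. -/
def kappaPlus (g : ℝ → ℂ) : ℂ := ∫ s in Set.Ioi (0 : ℝ), rho g s

/-- `κ₋ = ∫_{-∞}^0 ρ(s) ds`. -/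
def kappaMinus (g : ℝ → ℂ) : ℂ := ∫ s in Set.Iio (0 : ℝ), rho g s

/-- The denominator `I + i κ₊ E`. -/
def denom (E : 𝔥 →L[ℂ] 𝔥) (g : ℝ → ℂ) : 𝔥 →L[ℂ] 𝔥 := 1 + (I * kappaPlus g) • E

/-- The operator `S = (I - i κ₋ E) (I + i κ₊ E)⁻¹`. -/
def scattering (E : 𝔥 →L[ℂ] 𝔥) (g : ℝ → ℂ) : 𝔥 →L[ℂ] 𝔥 :=
  (1 - (I * kappaMinus g) • E) * Ring.inverse (denom E g)

/-- `f(0⁻) = a` and `f(0⁺) = b`, for the representative of `f` that is continuous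
on `ℝ ∖ {0}`. -/
def HasSideLimits (f : L2 𝔥) (a b : 𝔥) : Prop :=
  ∃ u : ℝ → 𝔥, f =ᵐ[volume] u ∧ ContinuousOn u {0}ᶜ ∧
    Tendsto u (𝓝[<] 0) (𝓝 a) ∧ Tendsto u (𝓝[>] 0) (𝓝 b)

/-- The space of all `f ∈ W^{1,2}(ℝ ∖ {0}; 𝔥)` with `f(0⁻) = S f(0⁺)`. -/
def jumpDomain (S : 𝔥 →L[ℂ] 𝔥) : Submodule ℂ (L2 𝔥) where
  carrier := {f | f ∈ W12 {0}ᶜ ∧ ∃ a b : 𝔥, HasSideLimits f a b ∧ a = S b}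
  add_mem' := by
    rintro f g ⟨hf, a, b, ⟨u, hu, huc, hua, hub⟩, hab⟩ ⟨hg, c, d, ⟨v, hv, hvc, hvc', hvd⟩, hcd⟩
    refine ⟨add_mem hf hg, a + c, b + d, ⟨u + v, ?_, huc.add hvc, hua.add hvc', hub.add hvd⟩, ?_⟩
    · exact (Lp.coeFn_add f g).trans (hu.add hv)
    · rw [hab, hcd, map_add]
  zero_mem' := ⟨zero_mem _, 0, 0, ⟨0, Lp.coeFn_zero 𝔥 2 volume, continuousOn_const,
    tendsto_const_nhds, tendsto_const_nhds⟩, (map_zero S).symm⟩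
  smul_mem' := by
    rintro z f ⟨hf, a, b, ⟨u, hu, huc, hua, hub⟩, hab⟩
    refine ⟨Submodule.smul_mem _ z hf, z • a, z • b,
      ⟨z • u, ?_, huc.const_smul z, hua.const_smul z, hub.const_smul z⟩, ?_⟩
    · exact (Lp.coeFn_smul z f).trans (hu.const_smul z)
    · rw [hab, map_smul]

theorem jumpDomain_le (S : 𝔥 →L[ℂ] 𝔥) : jumpDomain S ≤ W12 {0}ᶜ := fun _ hf => hf.1

/-- The operator `i ∂` with domain `{f ∈ W^{1,2}(ℝ ∖ {0}; 𝔥) : f(0⁻) = S f(0⁺)}`. -/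
def jumpHamiltonian [CompleteSpace 𝔥] (S : 𝔥 →L[ℂ] 𝔥) : L2 𝔥 →ₗ.[ℂ] L2 𝔥 where
  domain := jumpDomain S
  toFun := I • ((derivPunctured (𝔥 := 𝔥)).toFun ∘ₗ
    Submodule.inclusion (jumpDomain_le S))

/-! ### One-parameter unitary groups -/

/-- `U` is a strongly continuous one-parameter group of unitaries whose Stone generator is `A`,
that is, `U(t) = exp(-i t A)`: a vector `f` lies in the domain of `A` with `A f = h` if and only
if `t ↦ U(t) f` is differentiable at `0` with derivative `-i h`. -/
structure IsUnitaryGroupOf {K : Type*} [NormedAddCommGroup K] [InnerProductSpace ℂ K]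
    [CompleteSpace K] (A : K →ₗ.[ℂ] K) (U : ℝ → (K →L[ℂ] K)) : Prop where
  unitary : ∀ t, U t ∈ unitary (K →L[ℂ] K)
  map_zero : U 0 = 1
  map_add : ∀ s t, U (s + t) = U s * U t
  continuous : ∀ f, Continuous (fun t => U t f)
  generator : ∀ f h, (f, h) ∈ A.graph ↔ HasDerivAt (fun t => U t f) (-I • h) 0

end SingularLimit

end

/-! Write τ_t for translation, S for `scattering E g`, and J for `jumpMul S`, which multiplies by S
on the negative half-line. Conjugation by J turns continuity at 0 into the condition f(0⁻) = S
f(0⁺), so the limit group is explicit: U(t) = J τ_t J* (`isUnitaryGroupOf_jumpHamiltonian`). Each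
H^(k) is a bounded self-adjoint perturbation of i∂, and its group is built in the interaction
picture (`IsUnitaryGroupOf.exists_perturbation`). Groups with the same generator agree by a Duhamel
estimate (`IsUnitaryGroupOf.norm_apply_sub_le`).

The same estimate gives the convergence, through an approximate solution. Let G be the tail integral
of g. The factor G(kx) falls from 1 to 0 across |x| ≤ r/k, so Φ_k = 1 + G(kx)(S - 1) (`smoothJump`)
is a smoothed J, and for f in C¹ with compact support the curve s ↦ Φ_k τ_s f stays in the domain of
H^(k). At f it solves the evolution equation up to the error g^(k)(x) iE(b - (1 + κ₊(S - 1)) f(x)),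
where b = ∫ conj(g^(k)) Φ_k f. This form rests on the identity E(1 + κ₊(S - 1)) = i(S - 1), which is
what singles out S (`mul_one_add_smul_scattering_sub_one`).

If f were constant near 0, the bracket would vanish there; in general it is O(1/k). The error is
therefore bounded on an interval of length 2r/k and is O(k^(-1/2)) in L²
(`exists_mem_graph_smoothJump`). Replacing Φ_k by J costs another O(k^(-1/2)), and density with
unitarity covers all f (`tendsto_iSup_norm_sub`). -/

noncomputable section

namespace SingularLimit

/-! ### Unitary groups -/

section UnitaryGroups

variable {K : Type*} [NormedAddCommGroup K] [InnerProductSpace ℂ K]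

/-- Product rule for `s ↦ U (a s) (y s)` with `U` isometric and strongly continuous. -/
theorem hasDerivAt_isometric_apply {U : ℝ → (K →L[ℂ] K)} (hU : ∀ t x, ‖U t x‖ = ‖x‖)
    (hc : ∀ x, Continuous fun t => U t x) {a : ℝ → ℝ} (ha : Continuous a) {y : ℝ → K} {d e : K}
    {s : ℝ} (hy : HasDerivAt y d s) (he : HasDerivAt (fun r => U (a r) (y s)) e s) :
    HasDerivAt (fun r => U (a r) (y r)) (e + U (a s) d) s := by
  rw [hasDerivAt_iff_isLittleO] at hy he ⊢
  -- Isometry keeps the remainder of `y` small uniformly in `a r`; `U` itself need not be norm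
  -- continuous, so `h3` uses strong continuity at the fixed vector `d`.
  have h1 : (fun r => U (a r) (y r - y s - (r - s) • d)) =o[𝓝 s] fun r => r - s :=
    (hy.norm_left.congr_left fun r => (hU _ _).symm).of_norm_left
  have h3 : (fun r => (r - s) • (U (a r) d - U (a s) d)) =o[𝓝 s] fun r => r - s := by
    have : (fun r => U (a r) d - U (a s) d) =o[𝓝 s] fun _ => (1 : ℝ) := by
      rw [Asymptotics.isLittleO_one_iff]
      have h : Tendsto (fun r => U (a r) d - U (a s) d) (𝓝 s) (𝓝 (U (a s) d - U (a s) d)) :=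
        (((hc d).comp ha).sub continuous_const).tendsto s
      rwa [sub_self] at h
    simpa using (Asymptotics.isBigO_refl (fun r : ℝ => r - s) (𝓝 s)).smul_isLittleO this
  refine ((h1.add he).add h3).congr_left fun r => ?_
  simp only [map_sub, ContinuousLinearMap.map_smul_of_tower, smul_sub, smul_add]
  abel

variable [CompleteSpace K]

theorem norm_apply_of_mem_unitary {V : K →L[ℂ] K} (hV : V ∈ unitary (K →L[ℂ] K)) (x : K) :
    ‖V x‖ = ‖x‖ :=
  (V.norm_map_iff_adjoint_comp_self).2 (Unitary.star_mul_self_of_mem hV) x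

theorem mem_unitary_of_norm_map {V W : K →L[ℂ] K} (hV : ∀ x, ‖V x‖ = ‖x‖) (hVW : V * W = 1) :
    V ∈ unitary (K →L[ℂ] K) := by
  have h1 : star V * V = 1 := (V.norm_map_iff_adjoint_comp_self).1 hV
  refine Unitary.mem_iff.2 ⟨h1, ?_⟩
  have : star V = W := by
    calc star V = star V * (V * W) := by rw [hVW, mul_one]
      _ = W := by rw [← mul_assoc, h1, one_mul]
  rw [this, hVW]

namespace IsUnitaryGroupOf

variable {A : K →ₗ.[ℂ] K} {U V : ℝ → (K →L[ℂ] K)}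

theorem norm_apply (h : IsUnitaryGroupOf A U) (t : ℝ) (x : K) : ‖U t x‖ = ‖x‖ :=
  norm_apply_of_mem_unitary (h.unitary t) x

theorem hasDerivAt (h : IsUnitaryGroupOf A U) {f f' : K} (hf : (f, f') ∈ A.graph) (s : ℝ) :
    HasDerivAt (fun t => U t f) (U s (-I • f')) s := by
  have h0 := (h.generator f f').1 hf
  have h1 : HasDerivAt (fun t : ℝ => U (t - s) f) (-I • f') s := by
    have := HasDerivAt.comp_sub_const s s (f := fun t => U t f) (by simpa using h0)
    simpa using this
  have h2 := ((U s).restrictScalars ℝ).hasFDerivAt.comp_hasDerivAt s h1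
  refine h2.congr_of_eventuallyEq (Eventually.of_forall fun t => ?_)
  change U t f = (U s * U (t - s)) f
  rw [← h.map_add, add_sub_cancel]

theorem apply_mem_graph (h : IsUnitaryGroupOf A U) {f f' : K} (hf : (f, f') ∈ A.graph) (s : ℝ) :
    (U s f, U s f') ∈ A.graph := by
  rw [h.generator]
  have h0 := (h.generator f f').1 hf
  have h2 := ((U s).restrictScalars ℝ).hasFDerivAt.comp_hasDerivAt 0 h0
  have e : (U s).restrictScalars ℝ (-I • f') = -I • U s f' := (U s).map_smul _ _
  rw [e] at h2
  refine h2.congr_of_eventuallyEq (Eventually.of_forall fun t => ?_)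
  change (U t * U s) f = (U s * U t) f
  rw [← h.map_add, ← h.map_add, add_comm]

/-- A curve `y` which solves `i y' = A y` up to an error of size `C` deviates from the orbit of
`y 0` by at most `C |t|`. -/
theorem norm_apply_sub_le (h : IsUnitaryGroupOf A U) {y y' z : ℝ → K}
    (hy : ∀ s, HasDerivAt y (y' s) s) (hz : ∀ s, (y s, z s) ∈ A.graph) {C : ℝ}
    (hC : ∀ s, ‖y' s + I • z s‖ ≤ C) (t : ℝ) : ‖U t (y 0) - y t‖ ≤ C * |t| := by
  -- Duhamel: r ↦ U(t - r) y(r) joins U(t) y(0) to y(t), and its derivative is the rotated defect of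
  -- the equation.
  have key : ∀ s, HasDerivAt (fun r => U (t - r) (y r)) (U (t - s) (y' s + I • z s)) s := by
    intro s
    have e : HasDerivAt (fun r => U (t - r) (y s)) (-(U (t - s) (-I • z s))) s := by
      have := HasDerivAt.scomp s (h.hasDerivAt (hz s) (t - s)) ((hasDerivAt_id s).const_sub t)
      simpa [Function.comp_def] using this
    have := hasDerivAt_isometric_apply h.norm_apply h.continuous
      (a := fun r => t - r) (by fun_prop) (hy s) e
    convert this using 1
    rw [_root_.map_add, neg_smul, map_neg, neg_neg, add_comm]
  have := Convex.norm_image_sub_le_of_norm_hasDerivWithin_le (s := univ) (C := C)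
    (fun s _ => (key s).hasDerivWithinAt)
    (fun s _ => (h.norm_apply _ _).trans_le (hC s)) convex_univ (mem_univ t) (mem_univ 0)
  simpa [h.map_zero] using this

/-- The averages ε⁻¹ ∫₀^ε U(s)f ds lie in the domain and tend to f as ε → 0. -/
theorem dense_domain (h : IsUnitaryGroupOf A U) : Dense {f | ∃ f', (f, f') ∈ A.graph} := by
  intro f
  have hF : ∀ t : ℝ, HasDerivAt (fun t => ∫ s in (0 : ℝ)..t, U s f) (U t f) t := fun t =>
    intervalIntegral.integral_hasDerivAt_right ((h.continuous f).intervalIntegrable _ _)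
      ((h.continuous f).stronglyMeasurableAtFilter _ _) (h.continuous f).continuousAt
  have h0 : Tendsto (fun t : ℝ => t⁻¹ • ∫ s in (0 : ℝ)..t, U s f) (𝓝[≠] 0) (𝓝 f) := by
    have := (hasDerivAt_iff_tendsto_slope.1 (hF 0))
    simpa [slope_fun_def, h.map_zero] using this
  refine mem_closure_of_tendsto h0 (Eventually.of_forall fun ε => ?_)
  -- U(t) moves the window of integration to [t, t + ε], so only the endpoint values enter the
  -- derivative at 0.
  refine ⟨I • ε⁻¹ • (U ε f - f), ?_⟩
  rw [h.generator]
  have e1 : ∀ t, U t (ε⁻¹ • ∫ s in (0 : ℝ)..ε, U s f) = ε⁻¹ •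
      ((∫ s in (0 : ℝ)..(t + ε), U s f) - ∫ s in (0 : ℝ)..t, U s f) := by
    intro t
    rw [ContinuousLinearMap.map_smul_of_tower, ← (U t).intervalIntegral_comp_comm
      ((h.continuous f).intervalIntegrable _ _),
      intervalIntegral.integral_interval_sub_left ((h.continuous f).intervalIntegrable _ _)
        ((h.continuous f).intervalIntegrable _ _)]
    congr 1
    have := intervalIntegral.integral_comp_add_left (a := 0) (b := ε) (fun s => U s f) t
    simp only [add_zero] at this
    rw [← this]
    refine intervalIntegral.integral_congr fun s _ => ?_
    simp only [h.map_add]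
    rfl
  simp_rw [e1]
  have h2 := ((HasDerivAt.comp_add_const 0 ε (hF (0 + ε))).sub (hF 0)).const_smul ε⁻¹
  refine h2.congr_deriv ?_
  rw [smul_smul]
  simp [h.map_zero]

/-- A `U`-orbit in the domain solves the equation of `V` with zero defect, so Duhamel applies with
`C = 0`; density does the rest. -/
theorem unique (hU : IsUnitaryGroupOf A U) (hV : IsUnitaryGroupOf A V) : U = V := by
  funext t
  refine ContinuousLinearMap.ext fun f => ?_
  refine congrFun ((U t).continuous.ext_on hU.dense_domain (V t).continuous ?_) f
  rintro f ⟨f', hf⟩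
  have := hV.norm_apply_sub_le (fun s => hU.hasDerivAt hf s) (fun s => hU.apply_mem_graph hf s)
    (C := 0) (fun s => by simp) t
  simp only [hU.map_zero, one_apply_eq_self, zero_mul] at this
  exact (sub_eq_zero.1 (norm_le_zero_iff.1 this)).symm

/-- Transports a group along the unitary `M` with inverse `N`; used to obtain the group with a jump
from translations. -/
theorem conj (h : IsUnitaryGroupOf A U) {B : K →ₗ.[ℂ] K} {M N : K →L[ℂ] K}
    (hMN : M * N = 1) (hNM : N * M = 1) (hM : ∀ x, ‖M x‖ = ‖x‖)
    (hB : ∀ f f', (f, f') ∈ B.graph ↔ (N f, N f') ∈ A.graph) :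
    IsUnitaryGroupOf B fun t => M * U t * N := by
  have hMu := mem_unitary_of_norm_map hM hMN
  have hMN' : ∀ x, M (N x) = x := fun x => congrArg (fun T : K →L[ℂ] K => T x) hMN
  have hNM' : ∀ x, N (M x) = x := fun x => congrArg (fun T : K →L[ℂ] K => T x) hNM
  have hN : ∀ x, ‖N x‖ = ‖x‖ := fun x => by rw [← hM, hMN']
  have hNu := mem_unitary_of_norm_map hN hNM
  refine ⟨fun t => mul_mem (mul_mem hMu (h.unitary t)) hNu, by simp [h.map_zero, hMN], ?_, ?_, ?_⟩
  · intro s t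
    simp only [h.map_add, mul_assoc]
    rw [← mul_assoc N M, hNM, one_mul]
  · exact fun f => M.continuous.comp (h.continuous (N f))
  · intro f f'
    rw [hB, h.generator]
    constructor <;> intro H
    · have h2 := (M.restrictScalars ℝ).hasFDerivAt.comp_hasDerivAt 0 H
      have e : M.restrictScalars ℝ (-I • N f') = -I • f' := by
        rw [← hMN' f', hNM']
        exact M.map_smul _ _
      rwa [e] at h2
    · have h2 := (N.restrictScalars ℝ).hasFDerivAt.comp_hasDerivAt 0 H
      have e : N.restrictScalars ℝ (-I • f') = -I • N f' := N.map_smul _ _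
      rw [e] at h2
      refine h2.congr_of_eventuallyEq (Eventually.of_forall fun t => ?_)
      exact (hNM' _).symm

end IsUnitaryGroupOf

end UnitaryGroups

/-! ### Bounded perturbations -/

section Dyson

variable {R : Type*} [NormedRing R] [NormedAlgebra ℝ R]

/-- The terms of the Dyson series of the equation `W' = C W`, `W 0 = 1`. -/
def dysonTerm (C : ℝ → R) : ℕ → ℝ → R
  | 0, _ => 1
  | n + 1, t => ∫ s in (0 : ℝ)..t, C s * dysonTerm C n s

variable {C : ℝ → R} {M : ℝ}

theorem continuous_dysonTerm [CompleteSpace R] (hC : Continuous C) (n : ℕ) :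
    Continuous (dysonTerm C n) := by
  induction n with
  | zero => exact continuous_const
  | succ n ih =>
    exact intervalIntegral.continuous_primitive
      (fun _ _ => (hC.mul ih).intervalIntegrable _ _) 0

theorem hasDerivAt_dysonTerm [CompleteSpace R] (hC : Continuous C) (n : ℕ) (t : ℝ) :
    HasDerivAt (dysonTerm C (n + 1)) (C t * dysonTerm C n t) t := by
  have hc := hC.mul (continuous_dysonTerm hC n)
  exact intervalIntegral.integral_hasDerivAt_right (hc.intervalIntegrable _ _)
    (hc.stronglyMeasurableAtFilter _ _) hc.continuousAt

/-- Iterated integrals produce the factorial. The factor `‖1‖` stays because it is 0 for operators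
on the trivial space. -/
theorem norm_dysonTerm_le (hM : ∀ t, ‖C t‖ ≤ M) (n : ℕ)
    (t : ℝ) : ‖dysonTerm C n t‖ ≤ ‖(1 : R)‖ * ((M * |t|) ^ n / n.factorial) := by
  have hM0 : 0 ≤ M := (norm_nonneg _).trans (hM 0)
  induction n generalizing t with
  | zero => simp [dysonTerm]
  | succ n ih =>
    have hb : ∀ s, ‖C s * dysonTerm C n s‖ ≤
        (‖(1 : R)‖ * M ^ (n + 1) / n.factorial) * |s - 0| ^ n := by
      intro s
      calc ‖C s * dysonTerm C n s‖ ≤ ‖C s‖ * ‖dysonTerm C n s‖ := norm_mul_le _ _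
        _ ≤ M * (‖(1 : R)‖ * ((M * |s|) ^ n / n.factorial)) :=
          mul_le_mul (hM s) (ih s) (norm_nonneg _) hM0
        _ = _ := by rw [sub_zero, mul_pow]; ring
    have hcont : Continuous fun s : ℝ =>
        (‖(1 : R)‖ * M ^ (n + 1) / n.factorial) * |s - 0| ^ n := by fun_prop
    change ‖∫ s in (0 : ℝ)..t, C s * dysonTerm C n s‖ ≤ _
    rw [intervalIntegral.norm_integral_eq_norm_integral_uIoc]
    refine (norm_integral_le_of_norm_le
      (intervalIntegrable_iff.1 (hcont.intervalIntegrable 0 t))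
      (Eventually.of_forall hb)).trans_eq ?_
    rw [integral_const_mul, integral_pow_abs_sub_uIoc, sub_zero, Nat.factorial_succ]
    push_cast
    rw [mul_pow]
    field_simp

theorem exists_hasDerivAt_mul [CompleteSpace R] (hC : Continuous C) (hM : ∀ t, ‖C t‖ ≤ M) :
    ∃ W : ℝ → R, W 0 = 1 ∧ ∀ t, HasDerivAt W (C t * W t) t := by
  have hM0 : 0 ≤ M := (norm_nonneg _).trans (hM 0)
  have hsum : ∀ t : ℝ, Summable fun n => dysonTerm C n t := fun t =>
    Summable.of_norm_bounded ((Real.summable_pow_div_factorial (M * |t|)).mul_left ‖(1 : R)‖)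
      fun n => norm_dysonTerm_le hM n t
  refine ⟨fun t => ∑' n, dysonTerm C n t, ?_, fun t => ?_⟩
  · change ∑' n, dysonTerm C n 0 = 1
    rw [tsum_eq_single 0]
    · rfl
    · intro n hn
      obtain ⟨m, rfl⟩ := Nat.exists_eq_succ_of_ne_zero hn
      simp [dysonTerm]
  -- Splitting off the constant term aligns the indices: term n + 1 has derivative C times term n.
  · have h1 : (fun t => ∑' n, dysonTerm C n t) = fun t => 1 + ∑' n, dysonTerm C (n + 1) t := by
      funext s
      rw [(hsum s).tsum_eq_zero_add]
      rfl
    change HasDerivAt (fun t => ∑' n, dysonTerm C n t) (C t * ∑' n, dysonTerm C n t) t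
    rw [← (hsum t).tsum_mul_left, h1]
    refine HasDerivAt.const_add 1 ?_
    have hu : Summable fun n : ℕ => M * (‖(1 : R)‖ * ((M * (|t| + 1)) ^ n / n.factorial)) :=
      ((Real.summable_pow_div_factorial (M * (|t| + 1))).mul_left ‖(1 : R)‖).mul_left M
    have hs0 : Summable fun n => dysonTerm C (n + 1) t := (summable_nat_add_iff 1).2 (hsum t)
    -- The ball of radius |t| + 1 is a neighbourhood of t on which one summable majorant bounds all
    -- the derivatives.
    refine hasDerivAt_tsum_of_isPreconnected (t := Metric.ball 0 (|t| + 1)) (y₀ := t) hu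
      Metric.isOpen_ball (convex_ball 0 _).isPreconnected
      (fun n s _ => hasDerivAt_dysonTerm hC n s) ?_ ?_ hs0 ?_
    · intro n s hs
      have hs' : |s| ≤ |t| + 1 := by simpa using (mem_ball_zero_iff.1 hs).le
      have h2 : (M * |s|) ^ n / n.factorial ≤ (M * (|t| + 1)) ^ n / n.factorial :=
        div_le_div_of_nonneg_right
          (pow_le_pow_left₀ (by positivity) (mul_le_mul_of_nonneg_left hs' hM0) n) (by positivity)
      have h3 := (norm_dysonTerm_le hM n s).trans (mul_le_mul_of_nonneg_left h2 (norm_nonneg _))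
      exact (norm_mul_le _ _).trans (mul_le_mul (hM s) h3 (norm_nonneg _) hM0)
    · simp
    · simp

theorem eq_of_hasDerivAt_mul {W W' : ℝ → R} (hM : ∀ t, ‖C t‖ ≤ M)
    (hW : ∀ t, HasDerivAt W (C t * W t) t) (hW' : ∀ t, HasDerivAt W' (C t * W' t) t)
    (h0 : W 0 = W' 0) : W = W' := by
  refine ODE_solution_unique_univ (v := fun t x => C t * x) (s := fun _ => univ)
    (K := M.toNNReal) (t₀ := 0) (fun t => LipschitzWith.lipschitzOnWith ?_)
    (fun t => ⟨hW t, mem_univ _⟩) (fun t => ⟨hW' t, mem_univ _⟩) h0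
  refine LipschitzWith.of_dist_le_mul fun x y => ?_
  rw [dist_eq_norm, dist_eq_norm, ← mul_sub]
  exact (norm_mul_le _ _).trans
    (mul_le_mul_of_nonneg_right ((hM t).trans (Real.le_coe_toNNReal M)) (norm_nonneg _))

end Dyson

/-- Interaction picture: V(t) = U(t)W(t), where W' = CW, W(0) = 1 and C(t) = -i U(-t) B U(t). Norm
continuity of the coefficient lets the equation be solved in the Banach algebra of operators, with
no domain questions. -/
theorem IsUnitaryGroupOf.exists_perturbation {K : Type*} [NormedAddCommGroup K]
    [InnerProductSpace ℂ K] [CompleteSpace K] {A A' : K →ₗ.[ℂ] K} {U : ℝ → (K →L[ℂ] K)}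
    (h : IsUnitaryGroupOf A U) {B : K →L[ℂ] K} (hB : IsSelfAdjoint B)
    (hc : Continuous fun t => U (-t) * B * U t)
    (hA' : ∀ f f', (f, f') ∈ A'.graph ↔ (f, f' - B f) ∈ A.graph) :
    ∃ V, IsUnitaryGroupOf A' V := by
  have hUU : ∀ t, U t * U (-t) = 1 := fun t => by rw [← h.map_add, add_neg_cancel, h.map_zero]
  have hstar : ∀ t, star (U t) = U (-t) := fun t => by
    calc star (U t) = star (U t) * (U t * U (-t)) := by rw [hUU, mul_one]
      _ = U (-t) := by rw [← mul_assoc, Unitary.star_mul_self_of_mem (h.unitary t), one_mul]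
  set C : ℝ → (K →L[ℂ] K) := fun t => -I • (U (-t) * B * U t) with hCdef
  have hCc : Continuous C := hc.const_smul (-I)
  have hM : ∀ t, ‖C t‖ ≤ ‖B‖ := by
    intro t
    refine ContinuousLinearMap.opNorm_le_bound _ (norm_nonneg _) fun x => ?_
    change ‖-I • (U (-t) (B (U t x)))‖ ≤ _
    rw [norm_smul, norm_neg, norm_I, one_mul, h.norm_apply]
    exact (B.le_opNorm _).trans_eq (by rw [h.norm_apply])
  have hskew : ∀ t, star (C t) = -C t := by
    intro t
    simp only [hCdef, star_smul, star_mul, hstar, hB.star_eq, star_neg, neg_smul, neg_neg,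
      mul_assoc]
    simp
  obtain ⟨W, hW0, hW⟩ := exists_hasDerivAt_mul hCc hM
  -- The derivative is W*(C* + C)W, which vanishes as C is skew-adjoint.
  have hWW : ∀ t, star (W t) * W t = 1 := by
    have hd : ∀ t, HasDerivAt (fun t => star (W t) * W t) 0 t := by
      intro t
      refine ((hW t).star.mul (hW t)).congr_deriv ?_
      rw [star_mul, hskew]
      noncomm_ring
    intro t
    have := is_const_of_deriv_eq_zero (fun t => (hd t).differentiableAt)
      (fun t => (hd t).deriv) t 0
    simpa [hW0] using this
  have hWn : ∀ t x, ‖W t x‖ = ‖x‖ := fun t => ((W t).norm_map_iff_adjoint_comp_self).2 (hWW t)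
  have hadd : ∀ s t, U (s + t) * W (s + t) = U s * W s * (U t * W t) := by
    intro s t
    -- Since U(t)C(r + t) = C(r)U(t), both curves solve X' = CX with the same value at r = 0.
    have e := eq_of_hasDerivAt_mul (C := C) (W := fun r => U t * W (r + t))
      (W' := fun r => W r * (U t * W t)) hM ?_ ?_ (by simp [hW0])
    · have e' : U t * W (s + t) = W s * (U t * W t) := congrFun e s
      rw [h.map_add, mul_assoc, e', mul_assoc]
    · intro r
      have := ((hW (r + t)).comp_add_const r t).const_mul (U t)
      refine this.congr_deriv ?_
      simp only [hCdef, smul_mul_assoc, mul_smul_comm]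
      congr 1
      rw [h.map_add r t, neg_add_rev, h.map_add (-t) (-r)]
      simp only [← mul_assoc]
      rw [hUU, one_mul]
    · intro r
      refine ((hW r).mul_const (U t * W t)).congr_deriv (mul_assoc _ _ _)
  have hVn : ∀ t x, ‖(U t * W t) x‖ = ‖x‖ := fun t x => (h.norm_apply _ _).trans (hWn t x)
  have hWc : ∀ f, ∀ t, HasDerivAt (fun t => W t f) (C t (W t f)) t := fun f t => by
    exact ((ContinuousLinearMap.apply ℂ K f).restrictScalars ℝ).hasFDerivAt.comp_hasDerivAt t (hW t)
  refine ⟨fun t => U t * W t, fun t => ?_, by simp [h.map_zero, hW0], hadd, fun f => ?_, ?_⟩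
  · refine mem_unitary_of_norm_map (W := U (-t) * W (-t)) (hVn t) ?_
    rw [← hadd, add_neg_cancel, h.map_zero, hW0, one_mul]
  · refine continuous_iff_continuousAt.2 fun t => ?_
    have h1 : ContinuousAt (fun s => U s (W s f - W t f)) t := by
      have h0 : Tendsto (fun s => W s f - W t f) (𝓝 t) (𝓝 0) := by
        rw [← sub_self (W t f)]
        exact ((hWc f t).continuousAt.tendsto).sub tendsto_const_nhds
      rw [ContinuousAt, sub_self, _root_.map_zero]
      rw [tendsto_zero_iff_norm_tendsto_zero] at h0 ⊢
      exact h0.congr fun s => (h.norm_apply _ _).symm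
    refine (h1.add (h.continuous (W t f)).continuousAt).congr (Eventually.of_forall fun s => ?_)
    simp
  · intro f f'
    rw [hA', h.generator]
    have hB0 : HasDerivAt (fun t => W t f - f) (-I • B f) 0 := by
      refine ((hWc f 0).sub_const f).congr_deriv ?_
      simp [hCdef, hW0, h.map_zero]
    -- In U(t)W(t)f = U(t)f + U(t)(W(t)f - f) the second term is always differentiable at 0, so
    -- perturbation leaves the domain unchanged and adds `B f` to the generator.
    have hd : HasDerivAt (fun t => U t (W t f - f)) (-I • B f) 0 := by
      have := hasDerivAt_isometric_apply h.norm_apply h.continuous continuous_id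
        (y := fun t => W t f - f) (e := 0) hB0 (by simpa [hW0] using hasDerivAt_const 0 (0 : K))
      simpa [h.map_zero] using this
    constructor <;> intro H
    · refine ((H.add hd).congr_deriv ?_).congr_of_eventuallyEq (Eventually.of_forall fun t => ?_)
      · rw [smul_sub]; abel
      · simp
    · refine ((H.sub hd).congr_deriv ?_).congr_of_eventuallyEq (Eventually.of_forall fun t => ?_)
      · rw [smul_sub]
      · simp

/-! ### Translations of `L²(ℝ; F)` -/

section Translation

variable {F : Type*} [NormedAddCommGroup F] [InnerProductSpace ℂ F]

/-- The translation `(translate t f)(x) = f (x + t)` of `L²(ℝ; F)`. -/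
def translate (t : ℝ) : L2 F →L[ℂ] L2 F :=
  (Lp.compMeasurePreservingₗᵢ ℂ (fun x : ℝ => x + t)
    (measurePreserving_add_right volume t)).toContinuousLinearMap

theorem coeFn_translate (t : ℝ) (f : L2 F) : translate t f =ᵐ[volume] fun x => f (x + t) :=
  Lp.coeFn_compMeasurePreserving f (measurePreserving_add_right volume t)

theorem memLp_comp_add {F : Type*} [NormedAddCommGroup F] {f : ℝ → F} (hf : MemLp f 2 (volume : Measure ℝ)) (t : ℝ) :
    MemLp (fun x => f (x + t)) 2 (volume : Measure ℝ) :=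
  hf.comp_measurePreserving (measurePreserving_add_right volume t)

theorem translate_toLp {f : ℝ → F} (hf : MemLp f 2 (volume : Measure ℝ)) (t : ℝ) :
    translate t (hf.toLp f) = (memLp_comp_add hf t).toLp fun x => f (x + t) := rfl

theorem norm_translate (t : ℝ) (f : L2 F) : ‖translate t f‖ = ‖f‖ :=
  Lp.norm_compMeasurePreserving f (measurePreserving_add_right volume t)

theorem translate_zero : (translate 0 : L2 F →L[ℂ] L2 F) = 1 := by
  refine ContinuousLinearMap.ext fun f => Lp.ext ?_
  filter_upwards [coeFn_translate 0 f] with x hx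
  rw [hx, add_zero]
  rfl

theorem translate_add (s t : ℝ) :
    (translate (s + t) : L2 F →L[ℂ] L2 F) = translate s * translate t := by
  refine ContinuousLinearMap.ext fun f => Lp.ext ?_
  have h1 := (measurePreserving_add_right volume s).quasiMeasurePreserving.ae_eq_comp
    (coeFn_translate t f)
  have h2 := coeFn_translate s (translate t f)
  filter_upwards [coeFn_translate (s + t) f, h1, h2] with x hx h1 h2
  refine hx.trans (Eq.trans ?_ h2.symm)
  simp only [Function.comp_apply] at h1
  rw [h1, add_assoc]

theorem translate_apply_translate_neg (t : ℝ) (f : L2 F) : translate t (translate (-t) f) = f := by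
  change (translate t * translate (-t) : L2 F →L[ℂ] L2 F) f = f
  rw [← translate_add, add_neg_cancel, translate_zero]
  rfl

theorem continuous_translate (f : L2 F) : Continuous fun t => translate t f := by
  have hg : Continuous (fun t : ℝ => (⟨fun x : ℝ => x + t, by fun_prop⟩ : C(ℝ, ℝ))) :=
    ContinuousMap.continuous_of_continuous_uncurry _
      (continuous_snd.add continuous_fst : Continuous fun p : ℝ × ℝ => p.2 + p.1)
  exact (continuous_const (y := f)).compMeasurePreservingLp hg
    (fun t => measurePreserving_add_right volume t) (by norm_num)

theorem inner_translate (t : ℝ) (u f : L2 F) :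
    inner ℂ u (translate t f) = inner ℂ (translate (-t) u) f := by
  conv_lhs => rw [← translate_apply_translate_neg t u]
  exact LinearIsometry.inner_map_map (𝕜 := ℂ) (E := L2 F) (E' := L2 F)
    (Lp.compMeasurePreservingₗᵢ ℂ (fun x : ℝ => x + t) (measurePreserving_add_right volume t)) _ _

/-- With r replaced by r/k this is the source of every k^(-1/2) in the convergence estimates. -/
theorem norm_le_of_ae_le_on_Icc {F : Type*} [NormedAddCommGroup F] {f : L2 F} {r C : ℝ} (hr : 0 ≤ r) (hC : 0 ≤ C)
    (h1 : ∀ᵐ x, x ∈ Icc (-r) r → ‖f x‖ ≤ C) (h2 : ∀ᵐ x, x ∉ Icc (-r) r → f x = 0) :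
    ‖f‖ ≤ C * √(2 * r) := by
  have hm : MeasurableSet (Icc (-r) r) := measurableSet_Icc
  have hv : volume (Icc (-r) r) ≠ ⊤ := by simp
  have h := Lp.norm_le_norm_of_ae_le (f := f) (g := indicatorConstLp 2 hm hv (C : ℝ)) ?_
  · refine h.trans_eq ?_
    rw [norm_indicatorConstLp (by norm_num) (by norm_num), Real.norm_of_nonneg hC,
      Real.sqrt_eq_rpow, Measure.real, Real.volume_Icc, ENNReal.toReal_ofReal (by linarith)]
    norm_num
    left
    congr 1
    ring
  · filter_upwards [h1, h2, indicatorConstLp_coeFn (p := 2) (hs := hm) (hμs := hv) (c := (C : ℝ))]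
      with x h1 h2 h3
    rw [h3]
    by_cases hx : x ∈ Icc (-r) r
    · rw [indicator_of_mem hx, Real.norm_of_nonneg hC]
      exact h1 hx
    · rw [h2 hx, norm_zero]
      exact norm_nonneg _

theorem exists_eq_zero_of_hasCompactSupport {G : Type*} [Zero G] {f : ℝ → G}
    (hf : HasCompactSupport f) :
    ∃ r : ℝ, 0 < r ∧ ∀ x, r < |x| → f x = 0 := by
  obtain ⟨r, hr, h⟩ := hf.isCompact.isBounded.subset_ball_lt 0 0
  refine ⟨r, hr, fun x hx => image_eq_zero_of_notMem_tsupport fun hx' => ?_⟩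
  have := mem_ball_zero_iff.1 (h hx')
  rw [Real.norm_eq_abs] at this
  linarith

theorem memLp_of_hasCompactSupport {f : ℝ → F} (hf : ContDiff ℝ 1 f) (hc : HasCompactSupport f) :
    MemLp f 2 (volume : Measure ℝ) := hf.continuous.memLp_of_hasCompactSupport hc

theorem memLp_deriv {f : ℝ → F} (hf : ContDiff ℝ 1 f) (hc : HasCompactSupport f) :
    MemLp (deriv f) 2 (volume : Measure ℝ) :=
  (hf.continuous_deriv le_rfl).memLp_of_hasCompactSupport hc.deriv

/-- Uniform continuity of the derivative controls the difference quotient in sup norm; for |t| < 1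
all supports lie in one compact interval, so the control passes to L². -/
theorem hasDerivAt_translate_toLp_zero {f : ℝ → F} (hf : ContDiff ℝ 1 f)
    (hc : HasCompactSupport f) :
    HasDerivAt (fun t => translate t ((memLp_of_hasCompactSupport hf hc).toLp f))
      ((memLp_deriv hf hc).toLp (deriv f)) 0 := by
  obtain ⟨r, hr, hr0⟩ := exists_eq_zero_of_hasCompactSupport hc
  obtain ⟨r', hr', hr0'⟩ := exists_eq_zero_of_hasCompactSupport hc.deriv
  -- The extra 1 absorbs the shift by t, |t| < 1.
  set R := max r r' + 1 with hR
  have hRr : r + 1 ≤ R := by simp [hR]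
  have hRr' : r' + 1 ≤ R := by simp [hR]
  have huc : UniformContinuous (deriv f) :=
    hc.deriv.uniformContinuous_of_continuous (hf.continuous_deriv le_rfl)
  rw [hasDerivAt_iff_isLittleO, Asymptotics.isLittleO_iff]
  intro ε hε
  set ε' := ε / (√(2 * R) + 1) with hε'def
  have hε' : 0 < ε' := by positivity
  obtain ⟨δ, hδ, hδ'⟩ := Metric.uniformContinuous_iff.1 huc ε' hε'
  filter_upwards [Metric.ball_mem_nhds (0 : ℝ) (lt_min hδ one_pos)] with t ht
  rw [mem_ball_zero_iff, Real.norm_eq_abs, lt_min_iff] at ht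
  rw [sub_zero, translate_zero]
  have hpt : ∀ x, ‖f (x + t) - f x - t • deriv f x‖ ≤ ε' * |t| := by
    intro x
    have hd : ∀ s ∈ uIcc 0 t, HasDerivWithinAt (fun s => f (x + s) - s • deriv f x)
        (deriv f (x + s) - (1 : ℝ) • deriv f x) (uIcc 0 t) s := fun s _ =>
      (((hf.differentiable one_ne_zero (x + s)).hasDerivAt.comp_const_add x s).sub
        ((hasDerivAt_id s).smul_const _)).hasDerivWithinAt
    have := (convex_uIcc (0 : ℝ) t).norm_image_sub_le_of_norm_hasDerivWithin_le (C := ε') hd ?_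
      left_mem_uIcc right_mem_uIcc
    · simpa [sub_right_comm] using this
    · intro s hs
      rw [one_smul, ← dist_eq_norm]
      refine (hδ' ?_).le
      rw [dist_eq_norm, add_sub_cancel_left, Real.norm_eq_abs]
      have := abs_sub_left_of_mem_uIcc hs
      simp only [sub_zero] at this
      exact this.trans_lt ht.1
  have hae : (translate t ((memLp_of_hasCompactSupport hf hc).toLp f) -
      (memLp_of_hasCompactSupport hf hc).toLp f - t • (memLp_deriv hf hc).toLp (deriv f) : L2 F)
      =ᵐ[volume] fun x => f (x + t) - f x - t • deriv f x := by
    rw [translate_toLp]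
    filter_upwards [Lp.coeFn_sub
      (((memLp_comp_add (memLp_of_hasCompactSupport hf hc) t).toLp fun x => f (x + t)) -
      (memLp_of_hasCompactSupport hf hc).toLp f) (t • (memLp_deriv hf hc).toLp (deriv f)),
      Lp.coeFn_sub ((memLp_comp_add (memLp_of_hasCompactSupport hf hc) t).toLp fun x => f (x + t))
      ((memLp_of_hasCompactSupport hf hc).toLp f),
      Lp.coeFn_smul t ((memLp_deriv hf hc).toLp (deriv f)),
      (memLp_of_hasCompactSupport hf hc).coeFn_toLp, (memLp_deriv hf hc).coeFn_toLp,
      (memLp_comp_add (memLp_of_hasCompactSupport hf hc) t).coeFn_toLp] with x h1 h2 h3 h4 h5 h6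
    rw [h1, Pi.sub_apply, h2, Pi.sub_apply, h3, Pi.smul_apply, h4, h5, h6]
  refine (norm_le_of_ae_le_on_Icc (r := R) (C := ε' * |t|) (by linarith) (by positivity)
    (hae.mono fun x hx _ => (congrArg norm hx).trans_le (hpt x)) (hae.mono fun x hx hxR => ?_)).trans
    ?_
  · refine hx.trans ?_
    have hx' : R < |x| := by
      by_contra hcon
      exact hxR (abs_le.1 (not_lt.1 hcon))
    have hxt : r < |x + t| := by
      have := abs_sub_abs_le_abs_sub x (-t)
      rw [abs_neg, sub_neg_eq_add] at this
      linarith [ht.2]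
    have e1 := hr0 x (by linarith)
    have e2 := hr0' x (by linarith)
    simp only [hr0 _ hxt, e1, e2, sub_zero, smul_zero]
  · rw [Real.norm_eq_abs, mul_right_comm]
    refine mul_le_mul_of_nonneg_right ?_ (abs_nonneg t)
    rw [hε'def, div_mul_eq_mul_div, div_le_iff₀ (by positivity)]
    nlinarith [Real.sqrt_nonneg (2 * R)]

end Translation

/-! ### Weak derivatives on the line and the translation group -/

section WeakDerivative

variable {F : Type*} [NormedAddCommGroup F] [InnerProductSpace ℂ F]

theorem hasDerivAt_translate {f f' : L2 F} (h : HasDerivAt (fun t => translate t f) f' 0) (s : ℝ) :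
    HasDerivAt (fun t => translate t f) (translate s f') s := by
  have h1 : HasDerivAt (fun t : ℝ => translate (t - s) f) f' s := by
    have := HasDerivAt.comp_sub_const s s (f := fun t => translate t f) (by simpa using h)
    simpa using this
  have h2 := ((translate s : L2 F →L[ℂ] L2 F).restrictScalars ℝ).hasFDerivAt.comp_hasDerivAt s h1
  refine h2.congr_of_eventuallyEq (Eventually.of_forall fun t => ?_)
  change translate t f = (translate s * translate (t - s) : L2 F →L[ℂ] L2 F) f
  rw [← translate_add, add_sub_cancel]

theorem memLp_test {φ : ℝ → ℝ} (hφ : Continuous φ) (hc : HasCompactSupport φ) (v : F) :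
    MemLp (fun x => φ x • v) 2 (volume : Measure ℝ) :=
  (hφ.smul continuous_const).memLp_of_hasCompactSupport (hc.smul_right (f' := fun _ => v))

theorem hasDerivAt_translate_test {φ : ℝ → ℝ} (hφ : ContDiff ℝ ∞ φ) (hc : HasCompactSupport φ)
    (v : F) (s : ℝ) :
    HasDerivAt (fun t => translate t ((memLp_test hφ.continuous hc v).toLp _))
      (translate s ((memLp_test (hφ.continuous_deriv (by simp)) hc.deriv v).toLp _)) s := by
  have hu : ContDiff ℝ 1 fun x => φ x • v := (hφ.of_le (by simp)).smul contDiff_const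
  have h := hasDerivAt_translate_toLp_zero hu (hc.smul_right (f' := fun _ => v))
  refine hasDerivAt_translate (h.congr_deriv ?_) s
  congr 1
  funext x
  exact deriv_smul_const (hφ.differentiable (by simp) x) v

variable [CompleteSpace F]

/-- Pairing with φ ⊗ v makes vector-valued integration by parts a statement about inner products,
where translations can be moved to the other side. -/
theorem inner_test {φ : ℝ → ℝ} (hφ : Continuous φ) (hc : HasCompactSupport φ) (v : F) (f : L2 F) :
    inner ℂ ((memLp_test hφ hc v).toLp _) f = inner ℂ v (∫ x, φ x • f x) := by
  rw [L2.inner_def, ← integral_inner (integrable_test_smul hφ hc f)]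
  refine integral_congr_ae ?_
  filter_upwards [(memLp_test hφ hc v).coeFn_toLp] with x hx
  rw [hx, ← Complex.coe_smul, ← Complex.coe_smul, inner_smul_left, inner_smul_right, conj_ofReal]

theorem eq_of_forall_inner_test {f g : L2 F}
    (h : ∀ (φ : ℝ → ℝ) (hφ : ContDiff ℝ ∞ φ) (hc : HasCompactSupport φ) (v : F),
      inner ℂ ((memLp_test hφ.continuous hc v).toLp _) f =
        inner ℂ ((memLp_test hφ.continuous hc v).toLp _) g) : f = g := by
  have key : ∀ᵐ x ∂(volume : Measure ℝ), f x - g x = 0 := by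
    refine ae_eq_zero_of_integral_contDiff_smul_eq_zero
      (((Lp.memLp f).locallyIntegrable (by norm_num)).sub
        ((Lp.memLp g).locallyIntegrable (by norm_num))) fun φ h1 h2 => ?_
    simp only [smul_sub]
    rw [integral_sub (integrable_test_smul h1.continuous h2 f)
        (integrable_test_smul h1.continuous h2 g), sub_eq_zero]
    refine ext_inner_left ℂ fun v => ?_
    have := h φ h1 h2 v
    rwa [inner_test h1.continuous h2, inner_test h1.continuous h2] at this
  exact Lp.ext (key.mono fun x hx => sub_eq_zero.1 hx)

/-- Differentiate ⟨u, τ_t f⟩ = ⟨τ_{-t} u, f⟩ at t = 0 on both sides, with u = φ ⊗ v. -/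
theorem isWeakDeriv_univ_of_hasDerivAt_translate {f f' : L2 F}
    (h : HasDerivAt (fun t => translate t f) f' 0) : IsWeakDeriv univ f f' := by
  intro φ hφ hc _
  refine ext_inner_left ℂ fun v => ?_
  rw [← inner_test (hφ.continuous_deriv (by simp)) hc.deriv, inner_neg_right,
    ← inner_test hφ.continuous hc]
  have h1 := (hasDerivAt_const (0 : ℝ) ((memLp_test hφ.continuous hc v).toLp _)).inner ℂ h
  have h2 := (HasDerivAt.scomp (0 : ℝ) (hasDerivAt_translate_test hφ hc v (-0))
    (hasDerivAt_neg (0 : ℝ))).inner ℂ (hasDerivAt_const (0 : ℝ) f)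
  have h3 := h1.unique (h2.congr_of_eventuallyEq (Eventually.of_forall fun t =>
    inner_translate t _ f))
  simp only [inner_zero_left, add_zero, inner_zero_right, zero_add, neg_zero, translate_zero,
    neg_smul, one_smul, inner_neg_left] at h3
  rw [h3]
  simp

/-- The point is the formula τ_t f = f + ∫₀ᵗ τ_s f' ds, checked against test functions; the
integrand is continuous in L², so it can be differentiated. -/
theorem hasDerivAt_translate_of_isWeakDeriv_univ {f f' : L2 F} (h : IsWeakDeriv univ f f') :
    HasDerivAt (fun t => translate t f) f' 0 := by
  set G : ℝ → L2 F := fun t => ∫ s in (0 : ℝ)..t, translate s f' with hG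
  have hGd : ∀ t, HasDerivAt G (translate t f') t := fun t =>
    intervalIntegral.integral_hasDerivAt_right ((continuous_translate f').intervalIntegrable _ _)
      ((continuous_translate f').stronglyMeasurableAtFilter _ _)
      (continuous_translate f').continuousAt
  have key : ∀ t, translate t f = f + G t := by
    intro t
    refine eq_of_forall_inner_test fun φ hφ hc v => ?_
    set u := (memLp_test hφ.continuous hc v).toLp _ with hu
    set u' := (memLp_test (hφ.continuous_deriv (by simp)) hc.deriv v).toLp _ with hu'
    -- A translated test function is again a test function, so integration by parts holds at every
    -- t, not only at 0.
    have hshift : ∀ t, inner ℂ (translate (-t) u') f = -inner ℂ (translate (-t) u) f' := by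
      intro t
      have hψ : ContDiff ℝ ∞ fun x => φ (x + -t) := hφ.comp (contDiff_id.add contDiff_const)
      have hψc : HasCompactSupport fun x => φ (x + -t) :=
        hc.comp_homeomorph (Homeomorph.addRight (-t))
      have e1 : translate (-t) u = (memLp_test hψ.continuous hψc v).toLp _ := translate_toLp _ _
      have hd : deriv (fun x => φ (x + -t)) = fun x => deriv φ (x + -t) :=
        funext fun x => deriv_comp_add_const φ (-t) x
      have e2 : translate (-t) u' =
          (memLp_test (hψ.continuous_deriv (by simp)) hψc.deriv v).toLp _ := by
        rw [hu', translate_toLp]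
        congr 1
        rw [hd]
      rw [e1, e2, inner_test hψ.continuous hψc,
        inner_test (hψ.continuous_deriv (by simp)) hψc.deriv, h _ hψ hψc (subset_univ _), inner_neg_right]
    have hd : ∀ t, HasDerivAt (fun t => inner ℂ u (translate t f) - inner ℂ u (G t)) 0 t := by
      intro t
      have h1 := (HasDerivAt.scomp t (hasDerivAt_translate_test hφ hc v (-t))
        (hasDerivAt_neg t)).inner ℂ (hasDerivAt_const t f)
      have h2 := (hasDerivAt_const t u).inner ℂ (hGd t)
      refine ((h1.congr_of_eventuallyEq (Eventually.of_forall fun t =>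
        inner_translate t _ f)).sub h2).congr_deriv ?_
      rw [neg_smul, one_smul, inner_neg_left, ← hu', hshift, inner_translate t u f']
      simp
    have := is_const_of_deriv_eq_zero (fun t => (hd t).differentiableAt)
      (fun t => (hd t).deriv) t 0
    rw [inner_add_right]
    simpa [translate_zero, hG, sub_eq_iff_eq_add] using this
  have h0 := (hGd 0).const_add f
  rw [translate_zero] at h0
  exact h0.congr_of_eventuallyEq (Eventually.of_forall key)

theorem mem_graph_weakDeriv {X : Set ℝ} (hX : IsOpen X) (hX0 : volume Xᶜ = 0) (f f' : L2 F) :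
    (f, f') ∈ (weakDeriv X hX hX0).graph ↔ IsWeakDeriv X f f' := by
  rw [LinearPMap.mem_graph_iff]
  constructor
  · rintro ⟨y, rfl, rfl⟩
    exact Classical.choose_spec y.2
  · intro h
    exact ⟨⟨f, f', h⟩, rfl, IsWeakDeriv.unique hX hX0
      (Classical.choose_spec (⟨f', h⟩ : ∃ f', IsWeakDeriv X f f')) h⟩

theorem mem_graph_perturbedHamiltonian (E : F →L[ℂ] F) (γ : L2 ℂ) (f f' : L2 F) :
    (f, f') ∈ (perturbedHamiltonian E γ).graph ↔
      IsWeakDeriv univ f (-I • (f' - ket γ (E (bra γ f)))) := by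
  rw [← mem_graph_weakDeriv isOpen_univ (by simp), LinearPMap.mem_graph_iff,
    LinearPMap.mem_graph_iff]
  constructor
  · rintro ⟨y, rfl, rfl⟩
    refine ⟨y, rfl, ?_⟩
    change derivLine y = -I • ((I • derivLine y + ket γ (E (bra γ y))) - ket γ (E (bra γ y)))
    rw [add_sub_cancel_right, smul_smul]
    simp
  · rintro ⟨y, rfl, hy⟩
    refine ⟨y, rfl, ?_⟩
    change I • derivLine y + ket γ (E (bra γ y)) = f'
    change derivLine y = _ at hy
    rw [hy, smul_smul]
    simp

theorem mem_graph_jumpHamiltonian (S : F →L[ℂ] F) (f f' : L2 F) :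
    (f, f') ∈ (jumpHamiltonian S).graph ↔
      IsWeakDeriv {0}ᶜ f (-I • f') ∧ ∃ b, HasSideLimits f (S b) b := by
  rw [← mem_graph_weakDeriv isOpen_compl_singleton (by simp), LinearPMap.mem_graph_iff,
    LinearPMap.mem_graph_iff]
  constructor
  · rintro ⟨y, rfl, rfl⟩
    obtain ⟨hy, a, b, hab, rfl⟩ := y.2
    refine ⟨⟨⟨y, hy⟩, rfl, ?_⟩, b, hab⟩
    change derivPunctured (⟨y, hy⟩ : (derivPunctured (𝔥 := F)).domain) =
      -I • (I • derivPunctured (⟨y, hy⟩ : (derivPunctured (𝔥 := F)).domain))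
    rw [smul_smul]
    simp
  · rintro ⟨⟨y, rfl, hy⟩, b, hb⟩
    refine ⟨⟨y, y.2, S b, b, hb, rfl⟩, rfl, ?_⟩
    change I • derivPunctured y = f'
    change derivPunctured y = _ at hy
    rw [hy, smul_smul]
    simp

/-- With `E = 0` and `γ = 0` the perturbed operator is i∂ on W^{1,2}(ℝ), the free Hamiltonian from
which both families of groups are built. -/
theorem isUnitaryGroupOf_translate :
    IsUnitaryGroupOf (perturbedHamiltonian (0 : F →L[ℂ] F) 0) translate := by
  refine ⟨fun t => ?_, translate_zero, translate_add, continuous_translate, fun f f' => ?_⟩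
  · refine mem_unitary_of_norm_map (W := translate (-t)) (norm_translate t) ?_
    rw [← translate_add, add_neg_cancel, translate_zero]
  · rw [mem_graph_perturbedHamiltonian]
    simp only [zero_apply, map_zero, sub_zero]
    exact ⟨hasDerivAt_translate_of_isWeakDeriv_univ, isWeakDeriv_univ_of_hasDerivAt_translate⟩

end WeakDerivative

/-! ### Continuous representatives of Sobolev functions -/

section Sobolev

/-- Fubini over the region y < x, since a merely integrable `h` leaves no classical product rule to
apply. -/
theorem integral_deriv_smul_primitive {F : Type*} [NormedAddCommGroup F] [NormedSpace ℝ F]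
    [CompleteSpace F] {h : ℝ → F} (hh : LocallyIntegrable h volume) {φ : ℝ → ℝ}
    (hφ : ContDiff ℝ 1 φ) (hc : HasCompactSupport φ) :
    ∫ x, deriv φ x • ∫ y in (0 : ℝ)..x, h y = -∫ x, φ x • h x := by
  obtain ⟨r₀, hr₀, hφ0⟩ := exists_eq_zero_of_hasCompactSupport hc
  obtain ⟨r₁, hr₁, hφ1⟩ := exists_eq_zero_of_hasCompactSupport hc.deriv
  set r := max r₀ r₁ + 1 with hr
  have hr0 : r₀ < r := (le_max_left r₀ r₁).trans_lt (lt_add_one _)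
  have hr1 : r₁ < r := (le_max_right r₀ r₁).trans_lt (lt_add_one _)
  have hii : ∀ a b, IntervalIntegrable h volume a b := fun a b =>
    (hh.integrableOn_isCompact isCompact_uIcc).intervalIntegrable
  have hd : Integrable (deriv φ) :=
    (hφ.continuous_deriv le_rfl).integrable_of_hasCompactSupport hc.deriv
  -- The cutoff makes the kernel integrable on the plane. Starting the primitive at -r instead of 0
  -- adds a constant, which is invisible because ∫ φ' = 0.
  set H := indicator (Ioc (-r) r) h with hH
  have hHi : Integrable H := (integrable_indicator_iff measurableSet_Ioc).2
    ((hh.integrableOn_isCompact isCompact_Icc).mono_set Ioc_subset_Icc_self)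
  have hk : Integrable (Function.uncurry fun x y : ℝ =>
      indicator (Iio x) (fun y => deriv φ x • H y) y) (volume.prod volume) := by
    have := (hd.smul_prod hHi).indicator (measurableSet_lt measurable_snd measurable_fst)
    refine this.congr (Eventually.of_forall fun p => ?_)
    simp [indicator, Function.uncurry]
  have e1 : ∀ x, deriv φ x • ∫ y in (0 : ℝ)..x, h y = deriv φ x • (∫ y in (0 : ℝ)..(-r), h y) +
      ∫ y, indicator (Iio x) (fun y => deriv φ x • H y) y := by
    intro x
    by_cases hx : r₁ < |x|
    · simp [hφ1 x hx]
    · have hx' := abs_le.1 (not_lt.1 hx)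
      rw [integral_indicator measurableSet_Iio, integral_smul, ← smul_add, hH,
        setIntegral_indicator measurableSet_Ioc,
        ← intervalIntegral.integral_add_adjacent_intervals (hii 0 (-r)) (hii (-r) x),
        intervalIntegral.integral_of_le (a := -r) (b := x) (by linarith),
        integral_Ioc_eq_integral_Ioo]
      have hset : Iio x ∩ Ioc (-r) r = Ioo (-r) x := by
        ext y
        simp only [mem_Ioo, mem_inter_iff, mem_Iio, mem_Ioc]
        constructor
        · rintro ⟨h1, h2, _⟩
          exact ⟨h2, h1⟩
        · rintro ⟨h1, h2⟩
          exact ⟨h2, h1, by linarith⟩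
      rw [hset]
  have e2 : ∀ y, ∫ x, indicator (Iio x) (fun y => deriv φ x • H y) y = -(φ y • h y) := by
    intro y
    have : (fun x => indicator (Iio x) (fun y => deriv φ x • H y) y) =
        indicator (Ioi y) fun x => deriv φ x • H y := by
      funext x
      simp [indicator]
    rw [this, integral_indicator measurableSet_Ioi, integral_smul_const,
      hc.integral_Ioi_deriv_eq hφ, neg_smul]
    by_cases hy : r₀ < |y|
    · simp [hφ0 y hy]
    · have hy' := abs_le.1 (not_lt.1 hy)
      rw [hH, indicator_of_mem (mem_Ioc.2 ⟨by linarith, by linarith⟩)]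
  have e3 : ∫ x, deriv φ x = 0 := integral_eq_zero_of_hasDerivAt_of_integrable
    (fun x => (hφ.differentiable one_ne_zero x).hasDerivAt) hd
    (hφ.continuous.integrable_of_hasCompactSupport hc)
  have hk1 : Integrable fun x => ∫ y, indicator (Iio x) (fun y => deriv φ x • H y) y :=
    hk.integral_prod_left
  simp_rw [e1]
  rw [integral_add (hd.smul_const _) hk1, integral_smul_const, e3, zero_smul,
    zero_add, integral_integral_swap hk]
  simp_rw [e2]
  rw [integral_neg]

/-- Integrate from a point to the left of the support; zero mean makes the primitive vanish again on
the right. -/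
theorem exists_primitive_of_integral_eq_zero {θ : ℝ → ℝ} (hθ : ContDiff ℝ ∞ θ)
    (hc : HasCompactSupport θ) (h0 : ∫ x, θ x = 0) :
    ∃ φ : ℝ → ℝ, ContDiff ℝ ∞ φ ∧ HasCompactSupport φ ∧ deriv φ = θ := by
  obtain ⟨r, hr, hr0⟩ := exists_eq_zero_of_hasCompactSupport hc
  have hi : ∀ a b, IntervalIntegrable θ volume a b := fun a b =>
    hθ.continuous.intervalIntegrable _ _
  have hd : ∀ x, HasDerivAt (fun x => ∫ y in (-r - 1)..x, θ y) (θ x) x := fun x =>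
    intervalIntegral.integral_hasDerivAt_right (hi _ _)
      (hθ.continuous.stronglyMeasurableAtFilter _ _) hθ.continuous.continuousAt
  have hd' : deriv (fun x => ∫ y in (-r - 1)..x, θ y) = θ := funext fun x => (hd x).deriv
  refine ⟨fun x => ∫ y in (-r - 1)..x, θ y, ?_, ?_, hd'⟩
  · rw [contDiff_infty_iff_deriv, hd']
    exact ⟨fun x => (hd x).differentiableAt, hθ⟩
  · refine HasCompactSupport.of_support_subset_isCompact (isCompact_Icc (a := -r - 1) (b := r + 1))
      fun x hx => ?_
    by_contra hx'
    refine hx ?_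
    change ∫ y in (-r - 1)..x, θ y = 0
    rw [mem_Icc, not_and_or, not_le, not_le] at hx'
    rcases hx' with hx' | hx'
    · rw [intervalIntegral.integral_zero_ae]
      refine Eventually.of_forall fun y hy => hr0 y ?_
      rw [uIoc_of_ge hx'.le] at hy
      rw [abs_of_neg (by linarith [hy.2])]
      linarith [hy.2]
    · rw [intervalIntegral.integral_eq_integral_of_support_subset, h0]
      intro y hy
      have : |y| ≤ r := not_lt.1 fun h => hy (hr0 y h)
      rw [abs_le] at this
      exact ⟨by linarith, by linarith⟩

/-- The lemma of du Bois-Reymond. -/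
theorem exists_ae_eq_const_of_integral_deriv_smul_eq_zero {F : Type*} [NormedAddCommGroup F]
    [NormedSpace ℝ F] [CompleteSpace F] {w : ℝ → F} (hw : LocallyIntegrable w volume)
    (h : ∀ φ : ℝ → ℝ, ContDiff ℝ ∞ φ → HasCompactSupport φ → ∫ x, deriv φ x • w x = 0) :
    ∃ c : F, ∀ᵐ x, w x = c := by
  set η : ℝ → ℝ := (default : ContDiffBump (0 : ℝ)).normed volume with hη
  have hη1 : ContDiff ℝ ∞ η := ContDiffBump.contDiff_normed _
  have hηc : HasCompactSupport η := ContDiffBump.hasCompactSupport_normed _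
  have hηi : ∫ x, η x = 1 := ContDiffBump.integral_normed _
  set c : F := ∫ x, η x • w x with hc
  refine ⟨c, ?_⟩
  have hw' : LocallyIntegrable (fun x => w x - c) volume := hw.sub (locallyIntegrable_const c)
  refine (ae_eq_zero_of_integral_contDiff_smul_eq_zero hw' fun ψ hψ hψc => ?_).mono
    fun x hx => sub_eq_zero.1 hx
  set a := ∫ x, ψ x with ha
  -- Subtracting its mean times η makes ψ the derivative of a test function, against which `w`
  -- integrates to 0.
  have hθ : ContDiff ℝ ∞ fun x => ψ x - a * η x := hψ.sub (contDiff_const.mul hη1)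
  have hθc : HasCompactSupport fun x => ψ x - a * η x := hψc.sub hηc.mul_left
  have hψi : Integrable ψ := hψ.continuous.integrable_of_hasCompactSupport hψc
  have hηi' : Integrable η := hη1.continuous.integrable_of_hasCompactSupport hηc
  have hw1 := hw.integrable_smul_left_of_hasCompactSupport hψ.continuous hψc
  have hw2 := hw.integrable_smul_left_of_hasCompactSupport hη1.continuous hηc
  obtain ⟨φ, hφ, hφc, hφd⟩ := exists_primitive_of_integral_eq_zero hθ hθc (by
    rw [integral_sub hψi (hηi'.const_mul a), integral_const_mul, hηi, mul_one, sub_self])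
  have h0 := h φ hφ hφc
  rw [hφd] at h0
  simp only [sub_smul, mul_smul] at h0
  have hw3 : Integrable fun x => a • η x • w x := hw2.smul a
  rw [integral_sub hw1 hw3, integral_smul, ← hc] at h0
  simp only [smul_sub]
  rw [integral_sub hw1 (hψi.smul_const c), integral_smul_const, ← ha, h0]

variable {F : Type*} [NormedAddCommGroup F] [InnerProductSpace ℂ F]

theorem IsWeakDeriv.mono {X Y : Set ℝ} (hXY : X ⊆ Y) {f f' : L2 F} (h : IsWeakDeriv Y f f') :
    IsWeakDeriv X f f' := fun φ h1 h2 h3 => h φ h1 h2 (h3.trans hXY)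

variable [CompleteSpace F]

/-- Subtracting the primitive of `f'` leaves a function with zero weak derivative, hence a constant.
-/
theorem IsWeakDeriv.exists_continuous {f f' : L2 F} (h : IsWeakDeriv univ f f') :
    ∃ u : ℝ → F, Continuous u ∧ f =ᵐ[volume] u := by
  have hf : LocallyIntegrable f volume := (Lp.memLp f).locallyIntegrable (by norm_num)
  have hf' : LocallyIntegrable f' volume := (Lp.memLp f').locallyIntegrable (by norm_num)
  have hcont : Continuous fun x => ∫ y in (0 : ℝ)..x, f' y :=
    intervalIntegral.continuous_primitive (fun a b =>
      (hf'.integrableOn_isCompact isCompact_uIcc).intervalIntegrable) 0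
  obtain ⟨c, hc⟩ := exists_ae_eq_const_of_integral_deriv_smul_eq_zero
    (w := fun x => f x - ∫ y in (0 : ℝ)..x, f' y) (hf.sub hcont.locallyIntegrable)
    fun φ hφ hφc => by
      have hd : Continuous (deriv φ) := hφ.continuous_deriv (by simp)
      simp only [smul_sub]
      rw [integral_sub (integrable_test_smul hd hφc.deriv f)
        (hcont.locallyIntegrable.integrable_smul_left_of_hasCompactSupport hd hφc.deriv),
        integral_deriv_smul_primitive hf' (hφ.of_le (by simp)) hφc, h φ hφ hφc (subset_univ _),
        sub_self]
  exact ⟨fun x => c + ∫ y in (0 : ℝ)..x, f' y, continuous_const.add hcont,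
    hc.mono fun x hx => sub_eq_iff_eq_add.1 hx⟩

theorem IsWeakDeriv.exists_hasSideLimits {f f' : L2 F} (h : IsWeakDeriv univ f f') :
    ∃ b, HasSideLimits f b b := by
  obtain ⟨u, hu, hfu⟩ := h.exists_continuous
  exact ⟨u 0, u, hfu, hu.continuousOn, (hu.tendsto 0).mono_left nhdsWithin_le_nhds,
    (hu.tendsto 0).mono_left nhdsWithin_le_nhds⟩

/-- A function on the punctured line whose one-sided limits at `0` agree has no singular part in
its weak derivative. -/
theorem IsWeakDeriv.univ_of_hasSideLimits {f f' : L2 F} (h : IsWeakDeriv {0}ᶜ f f') {b : F}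
    (hb : HasSideLimits f b b) : IsWeakDeriv univ f f' := by
  obtain ⟨u₀, hfu₀, hu₀, hl, hr⟩ := hb
  set u := Function.update u₀ 0 b with hu
  have huc : Continuous u := by
    rw [continuous_iff_continuousAt]
    intro x
    rcases eq_or_ne x 0 with rfl | hx
    · rw [hu, continuousAt_update_same, ← nhdsLT_sup_nhdsGT]
      exact hl.sup hr
    · rw [hu, continuousAt_update_of_ne hx]
      exact hu₀.continuousAt (isOpen_compl_singleton.mem_nhds hx)
  have hne : ∀ᵐ x : ℝ, x ≠ 0 := by simp [ae_iff]
  have hfu : f =ᵐ[volume] u := by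
    filter_upwards [hfu₀, hne] with x h1 h2
    rw [h1, hu, Function.update_of_ne h2]
  intro φ hφ hφc _
  have hφd : Continuous (deriv φ) := hφ.continuous_deriv (by simp)
  set β : ContDiffBump (0 : ℝ) := ⟨1, 2, one_pos, one_lt_two⟩ with hβ
  have hβ1 : ContDiff ℝ ∞ β := β.contDiff
  have hβc : HasCompactSupport β := β.hasCompactSupport
  have hβd : Continuous (deriv β) := hβ1.continuous_deriv (by simp)
  -- χ_n vanishes near 0 and tends to 1 elsewhere, so χ_n φ is an admissible test function on the
  -- punctured line.
  set χ : ℕ → ℝ → ℝ := fun n x => 1 - β ((n + 1 : ℝ) * x) with hχ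
  have hn : ∀ n : ℕ, (0 : ℝ) < n + 1 := fun n => by positivity
  have hχ1 : ∀ n, ContDiff ℝ ∞ (χ n) := fun n =>
    contDiff_const.sub (hβ1.comp (contDiff_const.mul contDiff_id))
  have hχb : ∀ n x, ‖χ n x‖ ≤ 1 := fun n x => by
    rw [Real.norm_eq_abs, abs_le]
    have h1 := β.nonneg (x := (n + 1 : ℝ) * x)
    have h2 := β.le_one (x := (n + 1 : ℝ) * x)
    simp only [hχ]
    constructor <;> linarith
  have hχlim : ∀ x ≠ 0, Tendsto (fun n => χ n x) atTop (𝓝 1) := by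
    intro x hx
    have h1 : Tendsto (fun n : ℕ => (n + 1 : ℝ) * |x|) atTop atTop :=
      (tendsto_atTop_add_const_right _ _ tendsto_natCast_atTop_atTop).atTop_mul_const
        (abs_pos.2 hx)
    refine tendsto_const_nhds.congr' ?_
    filter_upwards [h1.eventually_ge_atTop 2] with n hn2
    have : β ((n + 1 : ℝ) * x) = 0 := β.zero_of_le_dist (by
      rw [dist_zero_right, Real.norm_eq_abs, abs_mul, abs_of_pos (hn n)]
      exact hn2)
    simp [hχ, this]
  have hlim : ∀ {ψ : ℝ → ℝ} {k : L2 F}, Continuous ψ → HasCompactSupport ψ →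
      Tendsto (fun n => ∫ x, χ n x • (ψ x • k x)) atTop (𝓝 (∫ x, ψ x • k x)) := by
    intro ψ k hψ hψc
    have hi := integrable_test_smul hψ hψc k
    refine tendsto_integral_of_dominated_convergence (fun x => ‖ψ x • k x‖)
      (fun n => (hχ1 n).continuous.aestronglyMeasurable.smul hi.aestronglyMeasurable) hi.norm
      (fun n => Eventually.of_forall fun x => ?_) (hne.mono fun x hx => ?_)
    · rw [norm_smul]
      exact mul_le_of_le_one_left (norm_nonneg _) (hχb n x)
    · simpa using (hχlim x hx).smul_const (ψ x • k x)
  have hχd : ∀ n x, deriv (χ n) x = -((n + 1 : ℝ) * deriv β ((n + 1 : ℝ) * x)) := by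
    intro n x
    have h1 := (hβ1.differentiable (by simp) ((n + 1 : ℝ) * x)).hasDerivAt.comp x
      ((hasDerivAt_id x).const_mul (n + 1 : ℝ))
    refine (h1.const_sub 1).deriv.trans ?_
    simp [mul_comm]
  have hφχ : ∀ n, (∫ x, χ n x • (deriv φ x • f x)) + ∫ x, (deriv (χ n) x * φ x) • f x =
      -∫ x, χ n x • (φ x • f' x) := by
    intro n
    have hc : HasCompactSupport fun x => χ n x * φ x := hφc.mul_left
    have h0 := h (fun x => χ n x * φ x) ((hχ1 n).mul hφ) hc ?_
    · have hd : ∀ x, deriv (fun x => χ n x * φ x) x • f x =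
          χ n x • (deriv φ x • f x) + (deriv (χ n) x * φ x) • f x := by
        intro x
        have := ((hχ1 n).differentiable (by simp) x).hasDerivAt.mul
          (hφ.differentiable (by simp) x).hasDerivAt
        rw [show (fun x => χ n x * φ x) = χ n * φ from rfl, this.deriv, add_smul, smul_smul,
          add_comm]
      simp only [hd, mul_smul (χ n _)] at h0
      rw [← h0, integral_add]
      · have := integrable_test_smul (φ := fun x => χ n x * deriv φ x)
          ((hχ1 n).continuous.mul hφd) hφc.deriv.mul_left f
        simpa only [mul_smul] using this
      · exact integrable_test_smul (((hχ1 n).continuous_deriv (by simp)).mul hφ.continuous)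
          hφc.mul_left f
    · intro x hx
      rw [mem_compl_singleton_iff]
      rintro rfl
      refine (notMem_tsupport_iff_eventuallyEq.2 ?_) hx
      filter_upwards [Metric.closedBall_mem_nhds (0 : ℝ) (inv_pos.2 (hn n))] with x hx
      have : β ((n + 1 : ℝ) * x) = 1 := β.one_of_mem_closedBall (by
        rw [mem_closedBall_zero_iff, Real.norm_eq_abs] at hx ⊢
        rw [abs_mul, abs_of_pos (hn n)]
        calc (n + 1 : ℝ) * |x| ≤ (n + 1) * (n + 1 : ℝ)⁻¹ :=
              mul_le_mul_of_nonneg_left hx (hn n).le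
          _ = 1 := mul_inv_cancel₀ (hn n).ne')
      simp [hχ, this]
  -- χ_n' has size n on an interval of length 1/n. Rescaling gives the limit -φ(0)u(0) ∫ β' = 0;
  -- here the equality of the two side limits is used.
  have hsing : Tendsto (fun n => ∫ x, (deriv (χ n) x * φ x) • f x) atTop (𝓝 0) := by
    have e1 : ∀ n, ∫ x, (deriv (χ n) x * φ x) • f x =
        -∫ y, deriv β y • (φ ((n + 1 : ℝ)⁻¹ * y) • u ((n + 1 : ℝ)⁻¹ * y)) := by
      intro n
      have h1 : ∫ x, (deriv (χ n) x * φ x) • f x = -((n + 1 : ℝ) • ∫ x,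
          (fun y => deriv β y • (φ ((n + 1 : ℝ)⁻¹ * y) • u ((n + 1 : ℝ)⁻¹ * y)))
            ((n + 1 : ℝ) * x)) := by
        rw [← integral_smul, ← integral_neg]
        refine integral_congr_ae (hfu.mono fun x hx => ?_)
        simp only [hx, hχd, inv_mul_cancel_left₀ (hn n).ne']
        module
      rw [h1, Measure.integral_comp_mul_left
        (fun y => deriv β y • (φ ((n + 1 : ℝ)⁻¹ * y) • u ((n + 1 : ℝ)⁻¹ * y))), abs_of_pos (inv_pos.2 (hn n)),
        smul_inv_smul₀ (hn n).ne']
    simp_rw [e1]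
    have hcu : Continuous fun x => φ x • u x := hφ.continuous.smul huc
    obtain ⟨B, hB⟩ := (isCompact_Icc (a := (-2 : ℝ)) (b := 2)).exists_bound_of_continuousOn
      hcu.continuousOn
    have hinv : Tendsto (fun n : ℕ => (n + 1 : ℝ)⁻¹) atTop (𝓝 0) :=
      tendsto_inv_atTop_zero.comp
        (tendsto_atTop_add_const_right _ _ tendsto_natCast_atTop_atTop)
    have h2 : Tendsto (fun n : ℕ => ∫ y, deriv β y •
        (φ ((n + 1 : ℝ)⁻¹ * y) • u ((n + 1 : ℝ)⁻¹ * y))) atTop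
        (𝓝 (∫ y, deriv β y • (φ 0 • u 0))) := by
      refine tendsto_integral_of_dominated_convergence (fun y => ‖deriv β y‖ * B)
        (fun n => (hβd.smul (hcu.comp (continuous_const.mul continuous_id))).aestronglyMeasurable)
        ((hβd.integrable_of_hasCompactSupport hβc.deriv).norm.mul_const B)
        (fun n => Eventually.of_forall fun y => ?_) (Eventually.of_forall fun y => ?_)
      · rw [norm_smul]
        by_cases hy : y ∈ Icc (-2 : ℝ) 2
        · refine mul_le_mul_of_nonneg_left (hB _ ?_) (norm_nonneg _)
          have hn1 : (n + 1 : ℝ)⁻¹ ≤ 1 := inv_le_one_of_one_le₀ (by simp)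
          rw [mem_Icc, ← abs_le] at hy ⊢
          rw [abs_mul, abs_of_pos (inv_pos.2 (hn n))]
          exact (mul_le_of_le_one_left (abs_nonneg _) hn1).trans hy
        · have : deriv β y = 0 := image_eq_zero_of_notMem_tsupport fun hy' => hy (by
            have := closure_minimal (support_deriv_subset.trans (β.tsupport_eq.subset))
              Metric.isClosed_closedBall hy'
            rwa [Real.closedBall_eq_Icc, zero_sub, zero_add] at this)
          simp [this]
      · have h3 : Tendsto (fun n : ℕ => (n + 1 : ℝ)⁻¹ * y) atTop (𝓝 0) := by
          simpa using hinv.mul_const y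
        exact tendsto_const_nhds.smul ((hcu.tendsto 0).comp h3)
    have h4 : ∫ y, deriv β y = 0 := integral_eq_zero_of_hasDerivAt_of_integrable
      (fun x => (hβ1.differentiable (by simp) x).hasDerivAt)
      (hβd.integrable_of_hasCompactSupport hβc.deriv)
      (hβ1.continuous.integrable_of_hasCompactSupport hβc)
    rw [integral_smul_const, h4, zero_smul] at h2
    simpa using h2.neg
  have hL := (hlim (k := f) hφd hφc.deriv).add hsing
  simp_rw [hφχ] at hL
  rw [add_zero] at hL
  exact tendsto_nhds_unique hL (hlim (k := f') hφ.continuous hφc).neg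

end Sobolev

/-! ### The unitary group of the perturbed Hamiltonian -/

section Perturbed

variable {F : Type*} [NormedAddCommGroup F] [InnerProductSpace ℂ F]

theorem norm_ket_le (γ : L2 ℂ) (v : F) : ‖ket γ v‖ ≤ ‖γ‖ * ‖v‖ := by
  rw [mul_comm]
  refine Lp.norm_le_mul_norm_of_ae_le_mul ?_
  filter_upwards [(memLp_ket γ v).coeFn_toLp] with x hx
  refine (congrArg norm hx).trans_le ?_
  rw [norm_smul, mul_comm]

/-- `ket γ` as a bounded operator. -/
def ketL (γ : L2 ℂ) : F →L[ℂ] L2 F := (ket γ).mkContinuous ‖γ‖ (norm_ket_le γ)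

theorem ketL_sub (γ γ' : L2 ℂ) : (ketL (γ - γ') : F →L[ℂ] L2 F) = ketL γ - ketL γ' := by
  refine ContinuousLinearMap.ext fun v => Lp.ext ?_
  filter_upwards [(memLp_ket (γ - γ') v).coeFn_toLp, (memLp_ket γ v).coeFn_toLp,
    (memLp_ket γ' v).coeFn_toLp, Lp.coeFn_sub γ γ', Lp.coeFn_sub (ket γ v) (ket γ' v)]
    with x h1 h2 h3 h4 h5
  refine h1.trans (Eq.trans ?_ h5.symm)
  rw [h4, Pi.sub_apply, Pi.sub_apply, sub_smul]
  exact (congrArg₂ (fun a b : F => a - b) h2 h3).symm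

/-- Continuity is in operator norm, so strong continuity of translations on γ becomes norm
continuity of the moving perturbation. -/
theorem continuous_ketL : Continuous (ketL : L2 ℂ → (F →L[ℂ] L2 F)) := by
  have h : LipschitzWith 1 (ketL : L2 ℂ → (F →L[ℂ] L2 F)) := by
    refine LipschitzWith.of_dist_le_mul fun γ γ' => ?_
    rw [dist_eq_norm, dist_eq_norm, ← ketL_sub, NNReal.coe_one, one_mul]
    exact LinearMap.mkContinuous_norm_le _ (norm_nonneg _) _
  exact h.continuous

theorem translate_ket (t : ℝ) (γ : L2 ℂ) (v : F) :
    translate t (ket γ v) = ket (translate t γ) v := by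
  refine Lp.ext ?_
  have h1 := (measurePreserving_add_right volume t).quasiMeasurePreserving.ae_eq_comp
    (memLp_ket γ v).coeFn_toLp
  filter_upwards [coeFn_translate t (ket γ v), h1, (memLp_ket (translate t γ) v).coeFn_toLp,
    coeFn_translate t γ] with x h1 h2 h3 h4
  refine h1.trans (Eq.trans h2 (Eq.trans ?_ h3.symm))
  simp only [Function.comp_apply, h4]

variable [CompleteSpace F]

theorem adjoint_ketL_apply (γ : L2 ℂ) (f : L2 F) :
    ContinuousLinearMap.adjoint (ketL γ) f = bra γ f := by
  refine ext_inner_left ℂ fun v => ?_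
  rw [ContinuousLinearMap.adjoint_inner_right, L2.inner_def]
  change _ = inner ℂ v (∫ s, (starRingEnd ℂ) (γ s) • f s)
  rw [← integral_inner (integrable_bra γ f)]
  refine integral_congr_ae ?_
  filter_upwards [(memLp_ket γ v).coeFn_toLp] with x hx
  refine (congrArg (fun w => inner ℂ w (f x)) hx).trans ?_
  rw [inner_smul_left, inner_smul_right]

theorem bra_translate (t : ℝ) (γ : L2 ℂ) (f : L2 F) :
    bra γ (translate t f) = bra (translate (-t) γ) f := by
  refine ext_inner_left ℂ fun v => ?_
  rw [← adjoint_ketL_apply, ← adjoint_ketL_apply, ContinuousLinearMap.adjoint_inner_right,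
    ContinuousLinearMap.adjoint_inner_right, inner_translate]
  exact congrArg (fun w => inner ℂ w f) (translate_ket (-t) γ v)

/-- The bounded operator `E |γ⟩⟨γ|`. -/
def ketBra (E : F →L[ℂ] F) (γ : L2 ℂ) : L2 F →L[ℂ] L2 F :=
  ketL γ ∘L E ∘L ContinuousLinearMap.adjoint (ketL γ)

theorem ketBra_apply (E : F →L[ℂ] F) (γ : L2 ℂ) (f : L2 F) :
    ketBra E γ f = ket γ (E (bra γ f)) :=
  congrArg (fun v => ket γ (E v)) (adjoint_ketL_apply γ f)

theorem isSelfAdjoint_ketBra {E : F →L[ℂ] F} (hE : IsSelfAdjoint E) (γ : L2 ℂ) :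
    IsSelfAdjoint (ketBra E γ) := by
  rw [ContinuousLinearMap.isSelfAdjoint_iff'] at hE ⊢
  rw [ketBra, ContinuousLinearMap.adjoint_comp, ContinuousLinearMap.adjoint_comp,
    ContinuousLinearMap.adjoint_adjoint, hE]
  rfl

/-- Conjugation by translations acts on γ alone: τ_{-t} E|γ⟩⟨γ| τ_t = E|τ_{-t}γ⟩⟨τ_{-t}γ|. This
supplies the norm continuity that the interaction picture needs. -/
theorem exists_isUnitaryGroupOf_perturbedHamiltonian {E : F →L[ℂ] F} (hE : IsSelfAdjoint E)
    (γ : L2 ℂ) : ∃ V, IsUnitaryGroupOf (perturbedHamiltonian E γ) V := by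
  refine isUnitaryGroupOf_translate.exists_perturbation (isSelfAdjoint_ketBra hE γ) ?_ ?_
  · have h : ∀ t, translate (-t) * ketBra E γ * translate t = ketBra E (translate (-t) γ) := by
      intro t
      refine ContinuousLinearMap.ext fun f => ?_
      change translate (-t) (ketBra E γ (translate t f)) = _
      rw [ketBra_apply, ketBra_apply, translate_ket, bra_translate]
    simp_rw [h]
    have hk : Continuous fun t : ℝ => (ketL (translate (-t) γ) : F →L[ℂ] L2 F) :=
      continuous_ketL.comp ((continuous_translate γ).comp continuous_neg)
    exact hk.clm_comp
      (continuous_const.clm_comp (ContinuousLinearMap.adjoint.continuous.comp hk))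
  · intro f f'
    rw [mem_graph_perturbedHamiltonian, mem_graph_perturbedHamiltonian, ketBra_apply]
    simp

end Perturbed

/-! ### Multiplication operators -/

section Multiplication

variable {F : Type*} [NormedAddCommGroup F] [InnerProductSpace ℂ F]

theorem memLp_mul {γ : ℝ → ℂ} (hm : Measurable γ) (hb : ∃ C, ∀ x, ‖γ x‖ ≤ C) (f : L2 F) :
    MemLp (fun x => γ x • f x) 2 (volume : Measure ℝ) := by
  obtain ⟨C, hC⟩ := hb
  refine (Lp.memLp f).of_le_mul (c := C)
    (hm.aestronglyMeasurable.smul (Lp.aestronglyMeasurable f)) (Eventually.of_forall fun x => ?_)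
  rw [norm_smul]
  exact mul_le_mul_of_nonneg_right (hC x) (norm_nonneg _)

/-- Multiplication by a bounded function. -/
def mulL (γ : ℝ → ℂ) (hm : Measurable γ) (hb : ∃ C, ∀ x, ‖γ x‖ ≤ C) : L2 F →L[ℂ] L2 F :=
  LinearMap.mkContinuousOfExistsBound
    { toFun := fun f => (memLp_mul hm hb f).toLp _
      map_add' := fun f g => by
        refine Lp.ext ?_
        filter_upwards [(memLp_mul hm hb (f + g)).coeFn_toLp, (memLp_mul hm hb f).coeFn_toLp,
          (memLp_mul hm hb g).coeFn_toLp, Lp.coeFn_add f g,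
          Lp.coeFn_add ((memLp_mul hm hb f).toLp _) ((memLp_mul hm hb g).toLp _)]
          with x h1 h2 h3 h4 h5
        rw [h1, h5, Pi.add_apply, h2, h3, h4, Pi.add_apply, smul_add]
      map_smul' := fun c f => by
        refine Lp.ext ?_
        filter_upwards [(memLp_mul hm hb (c • f)).coeFn_toLp, (memLp_mul hm hb f).coeFn_toLp,
          Lp.coeFn_smul c f, Lp.coeFn_smul c ((memLp_mul hm hb f).toLp _)] with x h1 h2 h3 h4
        rw [RingHom.id_apply, h1, h4, Pi.smul_apply, h2, h3, Pi.smul_apply, smul_comm] }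
    (by
      obtain ⟨C, hC⟩ := id hb
      refine ⟨C, fun f => Lp.norm_le_mul_norm_of_ae_le_mul ?_⟩
      filter_upwards [(memLp_mul hm hb f).coeFn_toLp] with x hx
      refine (congrArg norm hx).trans_le ?_
      rw [norm_smul]
      exact mul_le_mul_of_nonneg_right (hC x) (norm_nonneg _))

/-- The operator of multiplication by `x ↦ 1 + γ(x) T`. -/
def mulOp (γ : ℝ → ℂ) (hm : Measurable γ) (hb : ∃ C, ∀ x, ‖γ x‖ ≤ C) (T : F →L[ℂ] F) :
    L2 F →L[ℂ] L2 F := 1 + mulL γ hm hb ∘L T.compLpL 2 volume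

theorem coeFn_mulOp {γ : ℝ → ℂ} (hm : Measurable γ) (hb : ∃ C, ∀ x, ‖γ x‖ ≤ C) (T : F →L[ℂ] F)
    (f : L2 F) : mulOp γ hm hb T f =ᵐ[volume] fun x => f x + γ x • T (f x) := by
  filter_upwards [Lp.coeFn_add f (mulL γ hm hb (T.compLpL 2 volume f)),
    (memLp_mul hm hb (T.compLpL 2 volume f)).coeFn_toLp, T.coeFn_compLpL f] with x h1 h2 h3
  refine h1.trans ?_
  rw [Pi.add_apply, ← h3, ← h2]
  rfl

theorem measurable_indicator_Iio : Measurable (indicator (Iio (0 : ℝ)) (1 : ℝ → ℂ)) :=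
  measurable_one.indicator measurableSet_Iio

theorem exists_bound_indicator_Iio : ∃ C, ∀ x, ‖indicator (Iio (0 : ℝ)) (1 : ℝ → ℂ) x‖ ≤ C :=
  ⟨1, fun x => (norm_indicator_le_norm_self _ _).trans (by simp)⟩

/-- Multiplication by `L` on the negative half-line. -/
def jumpMul (L : F →L[ℂ] F) : L2 F →L[ℂ] L2 F :=
  mulOp (indicator (Iio 0) 1) measurable_indicator_Iio exists_bound_indicator_Iio (L - 1)

theorem coeFn_jumpMul (L : F →L[ℂ] F) (f : L2 F) :
    jumpMul L f =ᵐ[volume] fun x => if x < 0 then L (f x) else f x := by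
  filter_upwards [coeFn_mulOp measurable_indicator_Iio exists_bound_indicator_Iio (L - 1) f]
    with x hx
  refine hx.trans ?_
  by_cases h : x < 0 <;> simp [indicator, h]

theorem jumpMul_mul (L L' : F →L[ℂ] F) : jumpMul L * jumpMul L' = jumpMul (L * L') := by
  refine ContinuousLinearMap.ext fun f => Lp.ext ?_
  filter_upwards [coeFn_jumpMul L (jumpMul L' f), coeFn_jumpMul L' f, coeFn_jumpMul (L * L') f]
    with x h1 h2 h3
  refine h1.trans (Eq.trans ?_ h3.symm)
  rw [h2]
  by_cases h : x < 0 <;> simp [h]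

theorem jumpMul_one : jumpMul (1 : F →L[ℂ] F) = 1 := by
  refine ContinuousLinearMap.ext fun f => Lp.ext ?_
  filter_upwards [coeFn_jumpMul 1 f] with x h1
  refine h1.trans ?_
  simp

theorem norm_jumpMul_apply {L : F →L[ℂ] F} (hL : ∀ v, ‖L v‖ = ‖v‖) (f : L2 F) :
    ‖jumpMul L f‖ = ‖f‖ := by
  rw [Lp.norm_def, Lp.norm_def]
  refine congrArg ENNReal.toReal (eLpNorm_congr_norm_ae ?_)
  filter_upwards [coeFn_jumpMul L f] with x h1
  rw [h1]
  split_ifs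
  · exact hL _
  · rfl

theorem HasSideLimits.jumpMul {f : L2 F} {a b : F} (h : HasSideLimits f a b) (L : F →L[ℂ] F) :
    HasSideLimits (jumpMul L f) (L a) b := by
  obtain ⟨u, hfu, hu, ha, hb⟩ := h
  refine ⟨fun x => if x < 0 then L (u x) else u x, ?_, ?_, ?_, ?_⟩
  · filter_upwards [coeFn_jumpMul L f, hfu] with x h1 h2
    rw [h1, h2]
  · intro x hx
    have hc := hu.continuousAt (isOpen_compl_singleton.mem_nhds hx)
    refine ContinuousAt.continuousWithinAt ?_
    rcases lt_or_gt_of_ne hx with hx | hx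
    · refine (L.continuous.continuousAt.comp hc).congr ?_
      filter_upwards [Iio_mem_nhds hx] with y hy
      exact (if_pos hy).symm
    · refine hc.congr ?_
      filter_upwards [Ioi_mem_nhds hx] with y hy
      exact (if_neg (not_lt.2 (le_of_lt hy))).symm
  · refine ((L.continuous.tendsto a).comp ha).congr' ?_
    filter_upwards [self_mem_nhdsWithin] with y hy
    exact (if_pos hy).symm
  · refine hb.congr' ?_
    filter_upwards [self_mem_nhdsWithin] with y hy
    exact (if_neg (not_lt.2 (le_of_lt hy))).symm

/-- A function vanishing near 0 can be cut at 0 without losing smoothness: locally the result is the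
function or zero. -/
theorem indicator_Iio_eventuallyEq {G : Type*} [Zero G] {φ : ℝ → G} (h0 : φ =ᶠ[𝓝 0] 0) (x : ℝ) :
    indicator (Iio 0) φ =ᶠ[𝓝 x] φ ∧ x < 0 ∨ indicator (Iio 0) φ =ᶠ[𝓝 x] 0 ∧ 0 ≤ x := by
  rcases lt_trichotomy x 0 with hx | rfl | hx
  · left
    refine ⟨?_, hx⟩
    filter_upwards [Iio_mem_nhds hx] with y hy
    exact indicator_of_mem hy φ
  · right
    refine ⟨?_, le_rfl⟩
    filter_upwards [h0] with y hy
    simp [indicator, hy]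
  · right
    refine ⟨?_, hx.le⟩
    filter_upwards [Ioi_mem_nhds hx] with y hy
    exact indicator_of_notMem (fun h : y ∈ Iio 0 => lt_asymm (mem_Iio.1 h) hy) φ

variable [CompleteSpace F]

/-- Pairing φ with `jumpMul L f` gives ∫ φf + (L - 1) ∫ ψf with ψ = φ cut to x < 0, and ψ is again a
test function on the punctured line. -/
theorem IsWeakDeriv.jumpMul {f f' : L2 F} (h : IsWeakDeriv {0}ᶜ f f') (L : F →L[ℂ] F) :
    IsWeakDeriv {0}ᶜ (jumpMul L f) (jumpMul L f') := by
  intro φ hφ hc hs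
  have hφd : Continuous (deriv φ) := hφ.continuous_deriv (by simp)
  have h0 : φ =ᶠ[𝓝 0] 0 := notMem_tsupport_iff_eventuallyEq.1 fun h => hs h rfl
  set ψ := indicator (Iio 0) φ with hψdef
  have hψ : ContDiff ℝ ∞ ψ := by
    rw [contDiff_iff_contDiffAt]
    intro x
    rcases indicator_Iio_eventuallyEq h0 x with ⟨hx, _⟩ | ⟨hx, _⟩
    · exact hφ.contDiffAt.congr_of_eventuallyEq hx
    · exact contDiffAt_const.congr_of_eventuallyEq hx
  have hψs : tsupport ψ ⊆ tsupport φ := 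
    closure_mono (Set.support_indicator.subset.trans inter_subset_right)
  have hψc : HasCompactSupport ψ := hc.of_isClosed_subset (isClosed_tsupport _) hψs
  have hψd : ∀ x, deriv ψ x = indicator (Iio 0) (deriv φ) x := by
    intro x
    rcases indicator_Iio_eventuallyEq h0 x with ⟨hx, hx0⟩ | ⟨hx, hx0⟩
    · rw [hx.deriv_eq, indicator_of_mem (mem_Iio.2 hx0)]
    · rw [hx.deriv_eq, indicator_of_notMem (fun h : x ∈ Iio 0 => not_lt.2 hx0 (mem_Iio.1 h))]
      simp
  have key : ∀ (α β : ℝ → ℝ) (_ : Continuous α) (_ : HasCompactSupport α) (_ : Continuous β)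
      (_ : HasCompactSupport β) (_ : ∀ x, β x = indicator (Iio 0) α x) (k : L2 F),
      ∫ x, α x • SingularLimit.jumpMul L k x = (∫ x, α x • k x) + (L - 1) (∫ x, β x • k x) := by
    intro α β hα hαc hβ hβc hαβ k
    rw [← (L - 1).integral_comp_comm (integrable_test_smul hβ hβc k), ← integral_add
      (integrable_test_smul hα hαc k) ((L - 1).integrable_comp (integrable_test_smul hβ hβc k))]
    refine integral_congr_ae ?_
    filter_upwards [coeFn_jumpMul L k] with x hx
    rw [hx, hαβ]
    by_cases h : x < 0
    · simp [h]
    · simp [h]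
  rw [key (deriv φ) (deriv ψ) hφd hc.deriv (hψ.continuous_deriv (by simp)) hψc.deriv hψd,
    key φ ψ hφ.continuous hc hψ.continuous hψc (fun _ => rfl), h φ hφ hc hs,
    h ψ hψ hψc (hψs.trans hs), map_neg, neg_add]

/-- Multiplying by S* on the left half-line makes the two side limits equal. The singular part of
the derivative then disappears, and what remains is the free Hamiltonian. -/
theorem isUnitaryGroupOf_jumpHamiltonian {S : F →L[ℂ] F} (hS : S ∈ unitary (F →L[ℂ] F)) :
    IsUnitaryGroupOf (jumpHamiltonian S)
      fun t => jumpMul S * translate t * jumpMul (star S) := by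
  have h1 : S * star S = 1 := Unitary.mul_star_self_of_mem hS
  have h2 : star S * S = 1 := Unitary.star_mul_self_of_mem hS
  have hMN : jumpMul S * jumpMul (star S) = 1 := by rw [jumpMul_mul, h1, jumpMul_one]
  refine isUnitaryGroupOf_translate.conj hMN (by rw [jumpMul_mul, h2, jumpMul_one])
    (norm_jumpMul_apply (norm_apply_of_mem_unitary hS)) fun f f' => ?_
  rw [mem_graph_jumpHamiltonian, mem_graph_perturbedHamiltonian]
  simp only [zero_apply, map_zero, sub_zero, ← map_smul]
  constructor
  · rintro ⟨hf, b, hb⟩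
    have hb' := hb.jumpMul (star S)
    rw [show star S (S b) = b from congrArg (fun T : F →L[ℂ] F => T b) h2] at hb'
    exact (hf.jumpMul (star S)).univ_of_hasSideLimits hb'
  · intro hf
    have hMN' : ∀ k, jumpMul S (jumpMul (star S) k) = k := fun k =>
      congrArg (fun T : L2 F →L[ℂ] L2 F => T k) hMN
    have hf' := (hf.mono (subset_univ {0}ᶜ)).jumpMul S
    obtain ⟨b, hb⟩ := hf.exists_hasSideLimits
    have hb' := hb.jumpMul S
    rw [hMN'] at hb' hf'
    rw [hMN'] at hf'
    exact ⟨hf', b, hb'⟩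

end Multiplication

/-! ### The autocorrelation function and the scattering operator -/

section Scattering

/-- The tail integral `∫_x^∞ g(t) dt`. -/
def tailIntegral (g : ℝ → ℂ) (x : ℝ) : ℂ := ∫ t in Ioi x, g t

variable {g : ℝ → ℂ}

theorem integrable_autocorrelation (hg : Continuous g) (hgc : HasCompactSupport g) :
    Integrable (fun p : ℝ × ℝ => (starRingEnd ℂ) (g p.2) * g (p.2 + p.1))
      ((volume : Measure ℝ).prod volume) := by
  obtain ⟨r, hr, hr0⟩ := exists_eq_zero_of_hasCompactSupport hgc
  have hc : Continuous fun p : ℝ × ℝ => (starRingEnd ℂ) (g p.2) * g (p.2 + p.1) :=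
    (continuous_conj.comp (hg.comp continuous_snd)).mul
      (hg.comp (continuous_snd.add continuous_fst))
  refine hc.integrable_of_hasCompactSupport (HasCompactSupport.intro
    ((isCompact_Icc (a := -(2 * r)) (b := 2 * r)).prod (isCompact_Icc (a := -r) (b := r)))
    fun p hp => ?_)
  by_cases h2 : r < |p.2|
  · simp [hr0 _ h2]
  · have h3 : r < |p.2 + p.1| := by
      by_contra h3
      refine hp ⟨?_, abs_le.1 (not_lt.1 h2)⟩
      have h4 := abs_le.1 (not_lt.1 h2)
      have h5 := abs_le.1 (not_lt.1 h3)
      constructor <;> linarith [h4.1, h4.2, h5.1, h5.2]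
    simp [hr0 _ h3]

theorem setIntegral_Ioi_comp_add (g : ℝ → ℂ) (s : ℝ) :
    ∫ t in Ioi (0 : ℝ), g (s + t) = tailIntegral g s := by
  rw [tailIntegral, ← integral_indicator measurableSet_Ioi, ← integral_indicator measurableSet_Ioi,
    ← integral_add_left_eq_self (fun t => indicator (Ioi s) g t) s]
  congr 1
  funext t
  simp [indicator]

/-- Fubini. In this form κ₊ is what `bra` produces when applied to the smoothed jump. -/
theorem kappaPlus_eq (hg : Continuous g) (hgc : HasCompactSupport g) :
    kappaPlus g = ∫ s, (starRingEnd ℂ) (g s) * tailIntegral g s := by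
  have hi : Integrable (Function.uncurry fun t s : ℝ => (starRingEnd ℂ) (g s) * g (s + t))
      ((volume.restrict (Ioi (0 : ℝ))).prod volume) := by
    have := (integrable_autocorrelation hg hgc).mono_measure
      (Measure.prod_mono (Measure.restrict_le_self (μ := volume) (s := Ioi (0 : ℝ)))
        (le_refl (volume : Measure ℝ)))
    exact this
  simp only [kappaPlus, rho]
  rw [integral_integral_swap hi]
  congr 1
  funext s
  rw [integral_const_mul, setIntegral_Ioi_comp_add]

theorem rho_neg (g : ℝ → ℂ) (t : ℝ) : rho g (-t) = (starRingEnd ℂ) (rho g t) := by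
  rw [rho, rho, ← integral_conj,
    ← integral_add_right_eq_self (fun s => (starRingEnd ℂ) (g s) * g (s + -t)) t]
  congr 1
  funext s
  simp [mul_comm]

theorem kappaMinus_eq (g : ℝ → ℂ) : kappaMinus g = (starRingEnd ℂ) (kappaPlus g) := by
  rw [kappaMinus, kappaPlus, ← integral_conj, ← integral_Iic_eq_integral_Iio]
  have := integral_comp_neg_Ioi 0 (rho g)
  rw [neg_zero] at this
  rw [← this]
  simp_rw [rho_neg]

/-- The total integral of ρ is conj(∫ g) · ∫ g. -/
theorem kappaPlus_add_kappaMinus (hg : Continuous g) (hgc : HasCompactSupport g)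
    (hg1 : ∫ s, g s = 1) : kappaPlus g + kappaMinus g = 1 := by
  have hi := integrable_autocorrelation hg hgc
  have hρ : Integrable (rho g) := hi.integral_prod_left
  rw [kappaPlus, kappaMinus, ← integral_Iic_eq_integral_Iio, add_comm,
    intervalIntegral.integral_Iic_add_Ioi hρ.integrableOn hρ.integrableOn]
  have hi' : Integrable (Function.uncurry fun t s : ℝ => (starRingEnd ℂ) (g s) * g (s + t))
      (volume.prod volume) := hi
  simp only [rho]
  rw [integral_integral_swap hi']
  simp_rw [integral_const_mul, integral_add_left_eq_self, hg1, mul_one]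
  rw [integral_conj, hg1, map_one]

theorem re_kappaPlus (hg : Continuous g) (hgc : HasCompactSupport g) (hg1 : ∫ s, g s = 1) :
    (kappaPlus g).re = 1 / 2 := by
  have h := congrArg Complex.re (kappaPlus_add_kappaMinus hg hgc hg1)
  rw [kappaMinus_eq, add_re, conj_re, one_re] at h
  linarith

variable {F : Type*} [NormedAddCommGroup F] [InnerProductSpace ℂ F] [CompleteSpace F]
  {E : F →L[ℂ] F}

/-- iκ₊ has imaginary part Re κ₊ = 1/2, so -1/(iκ₊) is not real and lies outside the spectrum of the
self-adjoint `E`. -/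
theorem isUnit_denom (hE : IsSelfAdjoint E) (hg : Continuous g) (hgc : HasCompactSupport g)
    (hg1 : ∫ s, g s = 1) : IsUnit (denom E g) := by
  set z : ℂ := I * kappaPlus g with hz
  have hzim : z.im = 1 / 2 := by
    rw [hz, I_mul_im, re_kappaPlus hg hgc hg1]
  have hz0 : z ≠ 0 := fun h => by rw [h] at hzim; norm_num at hzim
  have hmem : -z⁻¹ ∉ spectrum ℂ E := fun h => by
    have := hE.im_eq_zero_of_mem_spectrum h
    rw [neg_im, inv_im, hzim, neg_eq_zero, div_eq_zero_iff] at this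
    rcases this with h | h
    · norm_num at h
    · exact hz0 (normSq_eq_zero.1 h)
  have h := (spectrum.notMem_iff.1 hmem).smul (Units.mk0 (-z) (neg_ne_zero.2 hz0))
  convert h using 1
  rw [Units.smul_mk0, smul_sub, Algebra.algebraMap_eq_smul_one, smul_smul, neg_mul_neg,
    mul_inv_cancel₀ hz0, one_smul, neg_smul, sub_neg_eq_add]
  rfl

theorem star_denom (hE : IsSelfAdjoint E) : star (denom E g) = 1 - (I * kappaMinus g) • E := by
  rw [denom, star_add, star_one, star_smul, hE.star_eq, kappaMinus_eq, sub_eq_add_neg, ← neg_smul]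
  congr 2
  simp

/-- As κ₋ is the conjugate of κ₊, the numerator is the adjoint of D = I + iκ₊E. Thus S = D* D⁻¹, and
D is normal. -/
theorem scattering_mem_unitary (hE : IsSelfAdjoint E) (hg : Continuous g)
    (hgc : HasCompactSupport g) (hg1 : ∫ s, g s = 1) :
    scattering E g ∈ unitary (F →L[ℂ] F) := by
  obtain ⟨u, hu⟩ := isUnit_denom hE hg hgc hg1
  have hcomm : u * star u = star u * u := by
    ext1
    rw [Units.val_mul, Units.val_mul, Units.coe_star, hu, star_denom hE, denom]
    simp only [mul_add, mul_sub, add_mul, sub_mul, one_mul, mul_one, smul_mul_smul_comm]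
    rw [mul_comm (I * kappaPlus g)]
    abel
  have hS : scattering E g = ((star u * u⁻¹ : (F →L[ℂ] F)ˣ) : F →L[ℂ] F) := by
    rw [scattering, ← star_denom hE, ← hu, Ring.inverse_unit, Units.val_mul, Units.coe_star]
  rw [hS, Unitary.mem_iff, ← Units.coe_star, ← Units.val_mul, ← Units.val_mul, star_mul, star_star,
    star_inv]
  constructor
  · rw [mul_assoc, ← mul_assoc u, hcomm, mul_assoc, mul_inv_cancel, mul_one, inv_mul_cancel,
      Units.val_one]
  · rw [mul_assoc, ← mul_assoc u⁻¹, ← mul_inv_rev, ← hcomm, mul_inv_rev, mul_assoc,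
      inv_mul_cancel, mul_one, mul_inv_cancel, Units.val_one]

/-- From κ₊ + κ₋ = 1 follow S - 1 = -iE D⁻¹ and 1 + κ₊(S - 1) = D⁻¹ with D the denominator. This
cancels the leading singular term in the convergence proof. -/
theorem mul_one_add_smul_scattering_sub_one (hE : IsSelfAdjoint E) (hg : Continuous g)
    (hgc : HasCompactSupport g) (hg1 : ∫ s, g s = 1) :
    E * (1 + kappaPlus g • (scattering E g - 1)) = I • (scattering E g - 1) := by
  have hu := isUnit_denom hE hg hgc hg1
  set R := Ring.inverse (denom E g) with hR
  have h1 : R + (I * kappaPlus g) • (E * R) = 1 := by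
    have := Ring.mul_inverse_cancel _ hu
    rw [← hR, denom, add_mul, one_mul, smul_mul_assoc] at this
    exact this
  have hκ : I * kappaMinus g = I - I * kappaPlus g := by
    rw [← mul_one_sub, ← kappaPlus_add_kappaMinus hg hgc hg1, add_sub_cancel_left]
  have hT : scattering E g - 1 = -(I • (E * R)) := by
    rw [scattering, ← hR, sub_mul, one_mul, smul_mul_assoc, hκ, sub_smul]
    rw [← h1]
    abel
  have h2 : 1 + kappaPlus g • (scattering E g - 1) = R := by
    rw [hT, smul_neg, smul_smul, mul_comm, ← h1]
    abel
  rw [h2, hT, smul_neg, smul_smul, I_mul_I, neg_smul, one_smul, neg_neg]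

end Scattering

/-! ### Convergence -/

section Convergence

/-! ### The tail integral of g and its rescaling -/

section Tail

variable {g : ℝ → ℂ}

theorem tailIntegral_eq_sub (hg : Continuous g) (hgc : HasCompactSupport g) (x : ℝ) :
    tailIntegral g x = tailIntegral g 0 - ∫ t in (0 : ℝ)..x, g t := by
  have hi := hg.integrable_of_hasCompactSupport hgc (μ := volume)
  rw [tailIntegral, tailIntegral, ← intervalIntegral.integral_interval_add_Ioi (a := 0) (b := x)
    hi.integrableOn hi.integrableOn, add_sub_cancel_left]

theorem hasDerivAt_tailIntegral (hg : Continuous g) (hgc : HasCompactSupport g) (x : ℝ) :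
    HasDerivAt (tailIntegral g) (-g x) x := by
  rw [funext (tailIntegral_eq_sub hg hgc)]
  exact (intervalIntegral.integral_hasDerivAt_right (hg.intervalIntegrable _ _)
    (hg.stronglyMeasurableAtFilter _ _) hg.continuousAt).const_sub _

theorem contDiff_tailIntegral (hg : Continuous g) (hgc : HasCompactSupport g) :
    ContDiff ℝ 1 (tailIntegral g) := by
  rw [contDiff_one_iff_deriv]
  refine ⟨fun x => (hasDerivAt_tailIntegral hg hgc x).differentiableAt, ?_⟩
  rw [funext fun x => (hasDerivAt_tailIntegral hg hgc x).deriv]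
  exact hg.neg

theorem norm_tailIntegral_le (hg : Continuous g) (hgc : HasCompactSupport g) (x : ℝ) :
    ‖tailIntegral g x‖ ≤ ∫ t, ‖g t‖ :=
  (norm_integral_le_integral_norm _).trans (setIntegral_le_integral
    (hg.integrable_of_hasCompactSupport hgc).norm (Eventually.of_forall fun _ => norm_nonneg _))

/-- Outside the support of `g` the smoothed step is the sharp step; the value 1 on the left is the
normalization of `g`. -/
theorem tailIntegral_eq_indicator (hg1 : ∫ s, g s = 1) {r : ℝ} (hr0 : ∀ x, r < |x| → g x = 0)
    {x : ℝ} (hx : r < |x|) : tailIntegral g x = indicator (Iio 0) 1 x := by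
  rcases lt_or_ge x 0 with h | h
  · rw [indicator_of_mem (mem_Iio.2 h), Pi.one_apply, ← hg1, tailIntegral]
    refine setIntegral_eq_integral_of_forall_compl_eq_zero fun y hy => hr0 y ?_
    rw [mem_Ioi, not_lt] at hy
    rw [abs_of_neg h] at hx
    rw [abs_of_neg (hy.trans_lt h)]
    linarith
  · rw [indicator_of_notMem (fun h' : x ∈ Iio 0 => not_lt.2 h (mem_Iio.1 h')), tailIntegral]
    refine setIntegral_eq_zero_of_forall_eq_zero fun y hy => hr0 y ?_
    rw [abs_of_nonneg h] at hx
    exact hx.trans ((mem_Ioi.1 hy).trans_le (le_abs_self y))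

theorem measurable_tailIntegral_mul (hg : Continuous g) (hgc : HasCompactSupport g) (k : ℝ) :
    Measurable fun x => tailIntegral g (k * x) :=
  ((contDiff_tailIntegral hg hgc).continuous.comp (continuous_const.mul continuous_id)).measurable

theorem exists_bound_tailIntegral_mul (hg : Continuous g) (hgc : HasCompactSupport g) (k : ℝ) :
    ∃ C, ∀ x, ‖tailIntegral g (k * x)‖ ≤ C :=
  ⟨_, fun x => norm_tailIntegral_le hg hgc (k * x)⟩

theorem integral_conj_scaled (hg1 : ∫ s, g s = 1) {k : ℝ} (hk : 0 < k) :
    ∫ s, (starRingEnd ℂ) (scaled g k s) = 1 := by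
  rw [integral_conj]
  simp only [scaled]
  rw [integral_const_mul, Measure.integral_comp_mul_left, hg1, abs_of_pos (inv_pos.2 hk)]
  simp [hk.ne']

theorem integral_conj_scaled_mul_tailIntegral (hg : Continuous g) (hgc : HasCompactSupport g)
    {k : ℝ} (hk : 0 < k) :
    ∫ s, (starRingEnd ℂ) (scaled g k s) * tailIntegral g (k * s) = kappaPlus g := by
  have h : ∀ s, (starRingEnd ℂ) (scaled g k s) * tailIntegral g (k * s) =
      (k : ℂ) * (fun y => (starRingEnd ℂ) (g y) * tailIntegral g y) (k * s) := fun s => by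
    simp [scaled, mul_assoc]
  simp_rw [h]
  rw [integral_const_mul, Measure.integral_comp_mul_left
    (fun y => (starRingEnd ℂ) (g y) * tailIntegral g y), ← kappaPlus_eq hg hgc,
    abs_of_pos (inv_pos.2 hk)]
  simp [hk.ne']

theorem continuous_scaled (hg : Continuous g) (k : ℝ) : Continuous (scaled g k) :=
  continuous_const.mul (hg.comp (continuous_const.mul continuous_id))

theorem scaled_eq_zero {r : ℝ} (hr0 : ∀ x, r < |x| → g x = 0) {k : ℝ} (hk : 0 < k) {x : ℝ}
    (hx : r / k < |x|) : scaled g k x = 0 := by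
  rw [scaled, hr0, mul_zero]
  rwa [abs_mul, abs_of_pos hk, mul_comm, ← div_lt_iff₀ hk]

theorem hasCompactSupport_scaled (hgc : HasCompactSupport g) {k : ℝ} (hk : 0 < k) :
    HasCompactSupport (scaled g k) :=
  (hgc.comp_homeomorph (Homeomorph.mulLeft₀ k hk.ne')).mul_left

end Tail

variable {F : Type*} [NormedAddCommGroup F] [InnerProductSpace ℂ F]

/-- The multiplication operator with which the jump at `0` is smoothed out on the scale `1/k`. -/
def smoothJump (g : ℝ → ℂ) (hg : Continuous g) (hgc : HasCompactSupport g) (k : ℝ)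
    (T : F →L[ℂ] F) : L2 F →L[ℂ] L2 F :=
  mulOp (fun x => tailIntegral g (k * x)) (measurable_tailIntegral_mul hg hgc k)
    (exists_bound_tailIntegral_mul hg hgc k) T

variable {g : ℝ → ℂ}

/-- The two multipliers differ only on |x| ≤ r/k, so a sup bound on `f` suffices. -/
theorem norm_smoothJump_sub_jumpMul_le (hg : Continuous g) (hgc : HasCompactSupport g)
    (hg1 : ∫ s, g s = 1) {r : ℝ} (hr : 0 < r) (hr0 : ∀ x, r < |x| → g x = 0) {k : ℝ} (hk : 0 < k)
    (S : F →L[ℂ] F) {f : L2 F} {B : ℝ} (hB : ∀ᵐ x, ‖f x‖ ≤ B) :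
    ‖smoothJump g hg hgc k (S - 1) f - jumpMul S f‖ ≤
      ((∫ t, ‖g t‖) + 1) * (‖S - 1‖ * B) * √(2 * (r / k)) := by
  have hB0 : 0 ≤ B := by
    obtain ⟨x, hx⟩ := hB.exists
    exact (norm_nonneg _).trans hx
  have hae : (smoothJump g hg hgc k (S - 1) f - jumpMul S f : L2 F) =ᵐ[volume] fun x =>
      (tailIntegral g (k * x) - indicator (Iio 0) 1 x) • (S - 1) (f x) := by
    filter_upwards [Lp.coeFn_sub (smoothJump g hg hgc k (S - 1) f) (jumpMul S f),
      coeFn_mulOp (measurable_tailIntegral_mul hg hgc k)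
        (exists_bound_tailIntegral_mul hg hgc k) (S - 1) f,
      coeFn_mulOp measurable_indicator_Iio exists_bound_indicator_Iio (S - 1) f] with x h1 h2 h3
    refine h1.trans ((congrArg₂ (fun a b : F => a - b) h2 h3).trans ?_)
    rw [sub_smul, add_sub_add_left_eq_sub]
  refine norm_le_of_ae_le_on_Icc (by positivity)
    (mul_nonneg (add_nonneg (integral_nonneg fun _ => norm_nonneg _) zero_le_one)
      (mul_nonneg (norm_nonneg _) hB0)) ?_ ?_
  · filter_upwards [hae, hB] with x hx hxB _
    rw [hx, norm_smul]
    refine mul_le_mul ((norm_sub_le _ _).trans (add_le_add (norm_tailIntegral_le hg hgc _) ?_))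
      (((S - 1).le_opNorm _).trans (mul_le_mul_of_nonneg_left hxB (norm_nonneg _)))
      (norm_nonneg _) (add_nonneg (integral_nonneg fun _ => norm_nonneg _) zero_le_one)
    exact (norm_indicator_le_norm_self _ _).trans (by simp)
  · filter_upwards [hae] with x hx hxr
    have hxk : r < |k * x| := by
      rw [abs_mul, abs_of_pos hk, mul_comm, ← div_lt_iff₀ hk]
      by_contra h
      exact hxr (abs_le.1 (not_lt.1 h))
    have hind : indicator (Iio (0 : ℝ)) (1 : ℝ → ℂ) (k * x) = indicator (Iio 0) 1 x := by
      simp [indicator, mul_neg_iff, hk, not_lt.2 hk.le]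
    rw [hx, tailIntegral_eq_indicator hg1 hr0 hxk, hind, sub_self, zero_smul]

variable [CompleteSpace F]

/-- The consistency estimate: the smoothed jump of f nearly intertwines ∂ with -iH^(k).
Differentiating G(kx) yields -g^(k), which the rank-one interaction compensates up to O(1/k). -/
theorem exists_mem_graph_smoothJump {E : F →L[ℂ] F} (hE : IsSelfAdjoint E)
    (hg : ContDiff ℝ ∞ g) (hgc : HasCompactSupport g) (hg1 : ∫ s, g s = 1) {r : ℝ} (hr : 0 < r)
    (hr0 : ∀ x, r < |x| → g x = 0) {G : ℝ} (hG : ∀ x, ‖g x‖ ≤ G) {k : ℝ} (hk : 0 < k) {f : ℝ → F}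
    (hf : ContDiff ℝ 1 f) (hfc : HasCompactSupport f) {L : ℝ}
    (hL : ∀ x y, ‖f x - f y‖ ≤ L * |x - y|) :
    ∃ z : L2 F, (smoothJump g hg.continuous hgc k (scattering E g - 1)
        ((memLp_of_hasCompactSupport hf hfc).toLp f), z) ∈
          (perturbedHamiltonian E (scaledL2 g hg hgc k)).graph ∧
      ‖smoothJump g hg.continuous hgc k (scattering E g - 1)
        ((memLp_deriv hf hfc).toLp (deriv f)) + I • z‖ ≤
        4 * ‖E‖ * G ^ 2 * (1 + (∫ t, ‖g t‖) * ‖scattering E g - 1‖) * r ^ 2 * L *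
          √(2 * (r / k)) := by
  set T := scattering E g - 1 with hT
  set γ : ℝ → ℂ := fun x => tailIntegral g (k * x) with hγ
  set A := ∫ t, ‖g t‖ with hA
  have hγd : ∀ x, HasDerivAt γ (-scaled g k x) x := by
    intro x
    have := (hasDerivAt_tailIntegral hg.continuous hgc (k * x)).scomp x
      ((hasDerivAt_id x).const_mul k)
    refine this.congr_deriv ?_
    simp [scaled]
  have hγc : ContDiff ℝ 1 γ :=
    (contDiff_tailIntegral hg.continuous hgc).comp (contDiff_const.mul contDiff_id)
  have hγA : ∀ x, ‖γ x‖ ≤ A := fun x => norm_tailIntegral_le hg.continuous hgc _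
  have hTf : ContDiff ℝ 1 fun x => T (f x) := (T.restrictScalars ℝ).contDiff.comp hf
  set w : ℝ → F := fun x => f x + γ x • T (f x) with hw
  have hwc : ContDiff ℝ 1 w := hf.add (hγc.smul hTf)
  have hwcs : HasCompactSupport w :=
    hfc.add ((hfc.comp_left (g := fun v => T v) (map_zero T)).smul_left (f := γ))
  have hwd : ∀ x, deriv w x = deriv f x + (γ x • T (deriv f x) + -scaled g k x • T (f x)) := by
    intro x
    have h1 := (hf.differentiable one_ne_zero x).hasDerivAt
    have h2 : HasDerivAt (fun x => T (f x)) (T (deriv f x)) x :=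
      (T.restrictScalars ℝ).hasFDerivAt.comp_hasDerivAt x h1
    exact (h1.add ((hγd x).smul h2)).deriv
  have hΦ : ∀ {u : ℝ → F} (hu : MemLp u 2 (volume : Measure ℝ)),
      smoothJump g hg.continuous hgc k T (hu.toLp u) =ᵐ[volume] fun x => u x + γ x • T (u x) := by
    intro u hu
    filter_upwards [coeFn_mulOp (measurable_tailIntegral_mul hg.continuous hgc k)
      (exists_bound_tailIntegral_mul hg.continuous hgc k) T (hu.toLp u), hu.coeFn_toLp]
      with x h1 h2
    rw [h2] at h1
    exact h1
  have hΦf : smoothJump g hg.continuous hgc k T ((memLp_of_hasCompactSupport hf hfc).toLp f) =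
      (memLp_of_hasCompactSupport hwc hwcs).toLp w :=
    Lp.ext ((hΦ _).trans (memLp_of_hasCompactSupport hwc hwcs).coeFn_toLp.symm)
  rw [hΦf]
  set b : F := bra (scaledL2 g hg hgc k) ((memLp_of_hasCompactSupport hwc hwcs).toLp w) with hb
  refine ⟨I • (memLp_deriv hwc hwcs).toLp (deriv w) + ket (scaledL2 g hg hgc k) (E b), ?_, ?_⟩
  · rw [mem_graph_perturbedHamiltonian, ← hb, add_sub_cancel_right, smul_smul, neg_mul, I_mul_I,
      neg_neg, one_smul]
    exact isWeakDeriv_univ_of_hasDerivAt_translate (hasDerivAt_translate_toLp_zero hwc hwcs)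
  have hgk : Continuous (scaled g k) := continuous_scaled hg.continuous k
  have hgkc : Continuous fun s => (starRingEnd ℂ) (scaled g k s) := continuous_conj.comp hgk
  have hgkcs : HasCompactSupport fun s => (starRingEnd ℂ) (scaled g k s) :=
    (hasCompactSupport_scaled hgc hk).comp_left (map_zero _)
  have hgkG : ∀ x, ‖scaled g k x‖ ≤ k * G := fun x => by
    rw [scaled, norm_mul, norm_real, Real.norm_of_nonneg hk.le]
    exact mul_le_mul_of_nonneg_left (hG _) hk.le
  have hb' : b = ∫ s, (starRingEnd ℂ) (scaled g k s) • w s := by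
    refine integral_congr_ae ?_
    filter_upwards [(memLp_scaled hg hgc k).coeFn_toLp,
      (memLp_of_hasCompactSupport hwc hwcs).coeFn_toLp] with s h1 h2
    rw [h2]
    exact congrArg (fun c => (starRingEnd ℂ) c • w s) h1
  -- For a constant function the pairing is exact and independent of k, because both integrals are
  -- scale invariant.
  have hconst : ∀ v : F, ∫ s, (starRingEnd ℂ) (scaled g k s) • (v + γ s • T v) =
      v + kappaPlus g • T v := by
    intro v
    simp only [smul_add, smul_smul]
    rw [integral_add, integral_smul_const, integral_smul_const, integral_conj_scaled hg1 hk,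
      integral_conj_scaled_mul_tailIntegral hg.continuous hgc hk, one_smul]
    · exact (hgkc.integrable_of_hasCompactSupport hgkcs).smul_const v
    · exact ((hgkc.mul hγc.continuous).integrable_of_hasCompactSupport
        hgkcs.mul_right).smul_const (T v)
  have hL0 : 0 ≤ L := by simpa using (norm_nonneg _).trans (hL 1 0)
  have hA0 : 0 ≤ A := (norm_nonneg _).trans (hγA 0)
  -- Compare `b` with its value for f frozen at x: the Lipschitz bound gives 2Lr/k, the factor k·G
  -- bounds g^(k), and the interval has length 2r/k, so the total is O(1/k).
  have hbx : ∀ x, |x| ≤ r / k → ‖b - (f x + kappaPlus g • T (f x))‖ ≤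
      k * G * ((1 + A * ‖T‖) * (L * (2 * (r / k)))) * (2 * (r / k)) := by
    intro x hx
    have hi : ∀ {u : ℝ → F}, Continuous u →
        Integrable fun s => (starRingEnd ℂ) (scaled g k s) • u s := fun hu =>
      (hgkc.smul hu).integrable_of_hasCompactSupport hgkcs.smul_right
    have hc2 : Continuous fun s => f x + γ s • T (f x) :=
      continuous_const.add (hγc.continuous.smul continuous_const)
    rw [← hconst, hb', ← integral_sub (hi hwc.continuous) (hi hc2),
      ← setIntegral_eq_integral_of_forall_compl_eq_zero (s := Icc (-(r / k)) (r / k))]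
    · refine (norm_setIntegral_le_of_norm_le_const
        (C := k * G * ((1 + A * ‖T‖) * (L * (2 * (r / k))))) (by simp) fun s hs => ?_).trans_eq ?_
      · rw [← smul_sub, norm_smul, RCLike.norm_conj]
        have hfs : ‖f s - f x‖ ≤ L * (2 * (r / k)) := by
          refine (hL s x).trans ?_
          refine mul_le_mul_of_nonneg_left ?_ hL0
          have hs' := abs_le.2 (mem_Icc.1 hs)
          exact (abs_sub s x).trans (by linarith)
        refine mul_le_mul (hgkG s) ?_ (norm_nonneg _) ((norm_nonneg _).trans (hgkG 0))
        have e : w s - (f x + γ s • T (f x)) = (f s - f x) + γ s • T (f s - f x) := by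
          simp only [hw, map_sub, smul_sub]
          abel
        rw [e, add_mul, one_mul]
        refine (norm_add_le _ _).trans (add_le_add hfs ?_)
        rw [norm_smul, mul_assoc]
        exact mul_le_mul (hγA s)
          ((T.le_opNorm _).trans (mul_le_mul_of_nonneg_left hfs (norm_nonneg _)))
          (norm_nonneg _) ((norm_nonneg _).trans (hγA 0))
      · rw [Measure.real, Real.volume_Icc, ENNReal.toReal_ofReal (by linarith [div_pos hr hk])]
        ring
    · intro s hs
      have : scaled g k s = 0 := scaled_eq_zero hr0 hk (by
        by_contra h
        exact hs (abs_le.1 (not_lt.1 h)))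
      simp [this]
  -- The identity for S rewrites T f(x) as -iE(1 + κ₊T) f(x).
  have hTx : ∀ x, T (f x) + I • E b = I • E (b - (f x + kappaPlus g • T (f x))) := by
    intro x
    have h1 : E (f x + kappaPlus g • T (f x)) = I • T (f x) :=
      congrArg (fun V : F →L[ℂ] F => V (f x))
        (mul_one_add_smul_scattering_sub_one hE hg.continuous hgc hg1)
    rw [map_sub, h1, smul_sub, smul_smul, I_mul_I, neg_smul, one_smul, sub_neg_eq_add, add_comm]
  have hae : (smoothJump g hg.continuous hgc k T ((memLp_deriv hf hfc).toLp (deriv f)) +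
      I • (I • (memLp_deriv hwc hwcs).toLp (deriv w) + ket (scaledL2 g hg hgc k) (E b)) : L2 F)
      =ᵐ[volume] fun x => scaled g k x • I • E (b - (f x + kappaPlus g • T (f x))) := by
    rw [smul_add, smul_smul, I_mul_I, neg_smul, one_smul]
    filter_upwards [Lp.coeFn_add (smoothJump g hg.continuous hgc k T
        ((memLp_deriv hf hfc).toLp (deriv f))) (-(memLp_deriv hwc hwcs).toLp (deriv w) +
          I • ket (scaledL2 g hg hgc k) (E b)),
      Lp.coeFn_add (-(memLp_deriv hwc hwcs).toLp (deriv w))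
        (I • ket (scaledL2 g hg hgc k) (E b)),
      Lp.coeFn_neg ((memLp_deriv hwc hwcs).toLp (deriv w)), (memLp_deriv hwc hwcs).coeFn_toLp,
      Lp.coeFn_smul I (ket (scaledL2 g hg hgc k) (E b)),
      (memLp_ket (scaledL2 g hg hgc k) (E b)).coeFn_toLp, (memLp_scaled hg hgc k).coeFn_toLp,
      hΦ (memLp_deriv hf hfc)] with x h1 h2 h3 h4 h5 h6 h7 h8
    have h6' : ket (scaledL2 g hg hgc k) (E b) x = scaled g k x • E b :=
      h6.trans (congrArg (fun c : ℂ => c • E b) h7)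
    rw [h1, Pi.add_apply, h2, Pi.add_apply, h3, Pi.neg_apply, h4, h5, Pi.smul_apply, h6', h8, hwd,
      ← hTx]
    module
  refine norm_le_of_ae_le_on_Icc (C := 4 * ‖E‖ * G ^ 2 * (1 + A * ‖T‖) * r ^ 2 * L)
    (by positivity) (by positivity) ?_ ?_
  · filter_upwards [hae] with x hx hxr
    have h1 := hbx x (abs_le.2 (mem_Icc.1 hxr))
    rw [hx, norm_smul, norm_smul, norm_I, one_mul]
    have h2 := (E.le_opNorm _).trans (mul_le_mul_of_nonneg_left h1 (norm_nonneg E))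
    refine (mul_le_mul (hgkG x) h2 (norm_nonneg _) ((norm_nonneg _).trans (hgkG 0))).trans_eq ?_
    field_simp
    ring
  · filter_upwards [hae] with x hx hxr
    rw [hx, scaled_eq_zero hr0 hk, zero_smul]
    by_contra h
    exact hxr (abs_le.1 (not_lt.1 h))

end Convergence

/-! ### Convergence on smooth data and passage to all of L² -/

section Limit

variable {F : Type*} [NormedAddCommGroup F] [InnerProductSpace ℂ F] [CompleteSpace F]
  {E : F →L[ℂ] F} {g : ℝ → ℂ}

/-- `C` comes from Duhamel along the approximate solution, `D` from exchanging the smoothed and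
sharp jumps at times 0 and t. Neither depends on k or t. -/
theorem exists_norm_sub_le (hE : IsSelfAdjoint E) (hg : ContDiff ℝ ∞ g)
    (hgc : HasCompactSupport g) (hg1 : ∫ s, g s = 1) {r : ℝ} (hr : 0 < r)
    (hr0 : ∀ x, r < |x| → g x = 0) {f : ℝ → F} (hf : ContDiff ℝ 1 f) (hfc : HasCompactSupport f) :
    ∃ C D : ℝ, ∀ k : ℝ, 0 < k → ∀ V, IsUnitaryGroupOf
      (perturbedHamiltonian E (scaledL2 g hg hgc k)) V → ∀ t,
      ‖V t (jumpMul (scattering E g) ((memLp_of_hasCompactSupport hf hfc).toLp f)) -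
        jumpMul (scattering E g) (translate t ((memLp_of_hasCompactSupport hf hfc).toLp f))‖ ≤
        (C * |t| + 2 * D) * √(2 * (r / k)) := by
  obtain ⟨G, hG⟩ := hgc.exists_bound_of_continuous hg.continuous
  obtain ⟨B, hB⟩ := hfc.exists_bound_of_continuous hf.continuous
  obtain ⟨L, hL⟩ := hf.lipschitzWith_of_hasCompactSupport hfc one_ne_zero
  have hL' : ∀ x y, ‖f x - f y‖ ≤ L * |x - y| := fun x y => by
    have := hL.dist_le_mul x y
    rwa [dist_eq_norm, Real.dist_eq] at this
  set S := scattering E g with hS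
  set p := (memLp_of_hasCompactSupport hf hfc).toLp f with hp
  set p' := (memLp_deriv hf hfc).toLp (deriv f) with hp'
  refine ⟨4 * ‖E‖ * G ^ 2 * (1 + (∫ t, ‖g t‖) * ‖S - 1‖) * r ^ 2 * L,
    ((∫ t, ‖g t‖) + 1) * (‖S - 1‖ * B), fun k hk V hV t => ?_⟩
  have hdiff : ∀ s, ‖smoothJump g hg.continuous hgc k (S - 1) (translate s p) -
      jumpMul S (translate s p)‖ ≤ ((∫ t, ‖g t‖) + 1) * (‖S - 1‖ * B) * √(2 * (r / k)) :=
    fun s => norm_smoothJump_sub_jumpMul_le hg.continuous hgc hg1 hr hr0 hk S <| by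
      filter_upwards [(memLp_comp_add (memLp_of_hasCompactSupport hf hfc) s).coeFn_toLp] with x hx
      rw [hp, translate_toLp, hx]
      exact hB _
  -- The consistency estimate is applied to f(· + s), whose Lipschitz constant does not depend on s;
  -- hence the bound is uniform in s.
  have hz : ∀ s, ∃ z, (smoothJump g hg.continuous hgc k (S - 1) (translate s p), z) ∈
      (perturbedHamiltonian E (scaledL2 g hg hgc k)).graph ∧
      ‖smoothJump g hg.continuous hgc k (S - 1) (translate s p') + I • z‖ ≤
        4 * ‖E‖ * G ^ 2 * (1 + (∫ t, ‖g t‖) * ‖S - 1‖) * r ^ 2 * L * √(2 * (r / k)) := by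
    intro s
    have hfs : ContDiff ℝ 1 fun x => f (x + s) := hf.comp (contDiff_id.add contDiff_const)
    have hfsc : HasCompactSupport fun x => f (x + s) := hfc.comp_homeomorph (Homeomorph.addRight s)
    obtain ⟨z, hz1, hz2⟩ := exists_mem_graph_smoothJump hE hg hgc hg1 hr hr0 hG hk hfs hfsc
      (L := L) fun x y => by simpa using hL' (x + s) (y + s)
    have e : translate s p' = (memLp_deriv hfs hfsc).toLp _ := by
      rw [hp', translate_toLp]
      congr 1
      exact funext fun x => (deriv_comp_add_const f s x).symm
    rw [e]
    exact ⟨z, hz1, hz2⟩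
  choose z hz1 hz2 using hz
  have hy : ∀ s, HasDerivAt (fun s => smoothJump g hg.continuous hgc k (S - 1) (translate s p))
      (smoothJump g hg.continuous hgc k (S - 1) (translate s p')) s := fun s =>
    ((smoothJump g hg.continuous hgc k (S - 1)).restrictScalars ℝ).hasFDerivAt.comp_hasDerivAt s
      (hasDerivAt_translate (hasDerivAt_translate_toLp_zero hf hfc) s)
  have h1 := hV.norm_apply_sub_le hy hz1 hz2 t
  have h2 := hdiff 0
  have h3 := hdiff t
  simp only [translate_zero, one_apply_eq_self] at h1 h2
  rw [norm_sub_rev, ← hV.norm_apply t, map_sub] at h2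
  refine (norm_sub_le_norm_sub_add_norm_sub _ (V t (smoothJump g hg.continuous hgc k (S - 1) p))
    _).trans ?_
  refine (add_le_add h2 ((norm_sub_le_norm_sub_add_norm_sub _
    (smoothJump g hg.continuous hgc k (S - 1) (translate t p)) _).trans
      (add_le_add h1 h3))).trans_eq ?_
  ring

theorem tendsto_iSup_norm_sub (hE : IsSelfAdjoint E) (hg : ContDiff ℝ ∞ g)
    (hgc : HasCompactSupport g) (hg1 : ∫ s, g s = 1) {Uk : ℝ → ℝ → (L2 F →L[ℂ] L2 F)}
    {U : ℝ → (L2 F →L[ℂ] L2 F)}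
    (hUk : ∀ k : ℝ, 0 < k →
      IsUnitaryGroupOf (perturbedHamiltonian E (scaledL2 g hg hgc k)) (Uk k))
    (hU : IsUnitaryGroupOf (jumpHamiltonian (scattering E g)) U) (T : ℝ) (f : L2 F) :
    Tendsto (fun k : ℝ => ⨆ t : Set.Icc (0 : ℝ) T, ‖(Uk k t - U t) f‖) atTop (𝓝 0) := by
  obtain ⟨r, hr, hr0⟩ := exists_eq_zero_of_hasCompactSupport hgc
  set S := scattering E g with hSdef
  have hS : S ∈ unitary (F →L[ℂ] F) := scattering_mem_unitary hE hg.continuous hgc hg1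
  have hSS : jumpMul S * jumpMul (star S) = 1 := by
    rw [jumpMul_mul, Unitary.mul_star_self_of_mem hS, jumpMul_one]
  have hSS' : jumpMul (star S) * jumpMul S = 1 := by
    rw [jumpMul_mul, Unitary.star_mul_self_of_mem hS, jumpMul_one]
  have hUeq := hU.unique (isUnitaryGroupOf_jumpHamiltonian hS)
  rw [Metric.tendsto_nhds]
  intro ε hε
  -- The approximation is made after removing the jump, since the estimate holds for vectors Jp with
  -- p smooth; J is isometric, so f is then approximated by Jp equally well.
  obtain ⟨p, ⟨q, hpq, hqc, hq⟩, hpd⟩ := (Lp.dense_hasCompactSupport_contDiff (E := ℝ) (F := F)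
    (μ := volume) (p := 2) (by norm_num)).exists_dist_lt (jumpMul (star S) f)
    (ε := ε / 8) (by positivity)
  have hq1 : ContDiff ℝ 1 q := hq.of_le (by simp)
  have hpeq : p = (memLp_of_hasCompactSupport hq1 hqc).toLp q :=
    Lp.ext (hpq.trans (memLp_of_hasCompactSupport hq1 hqc).coeFn_toLp.symm)
  obtain ⟨C, D, hCD⟩ := exists_norm_sub_le hE hg hgc hg1 hr hr0 hq1 hqc
  rw [← hpeq] at hCD
  have hfp : ‖f - jumpMul S p‖ < ε / 8 := by
    have e : f = jumpMul S (jumpMul (star S) f) :=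
      (congrArg (fun V : L2 F →L[ℂ] L2 F => V f) hSS).symm
    rw [e, ← map_sub, norm_jumpMul_apply (norm_apply_of_mem_unitary hS), ← dist_eq_norm]
    exact hpd
  have hlim : Tendsto (fun k : ℝ => (|C| * |T| + 2 * |D|) * √(2 * (r / k))) atTop (𝓝 0) := by
    have h1 : Tendsto (fun k : ℝ => 2 * (r / k)) atTop (𝓝 0) := by
      simpa using ((tendsto_const_nhds (x := r)).div_atTop
        (tendsto_id (α := ℝ) (x := atTop))).const_mul (2 : ℝ)
    simpa using ((Real.continuous_sqrt.tendsto 0).comp h1).const_mul (|C| * |T| + 2 * |D|)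
  filter_upwards [hlim.eventually_lt_const (by positivity : (0 : ℝ) < ε / 8),
    eventually_gt_atTop 0] with k hk hk0
  have hle : ∀ t : Set.Icc (0 : ℝ) T, ‖(Uk k t - U t) f‖ ≤ ε / 2 := by
    rintro ⟨t, ht⟩
    have hUt : U t (jumpMul S p) = jumpMul S (translate t p) := by
      rw [hUeq]
      change jumpMul S (translate t ((jumpMul (star S) * jumpMul S) p)) = _
      rw [hSS']
      rfl
    have htT : |t| ≤ |T| := abs_le_abs_of_nonneg ht.1 ht.2
    have h1 : ‖Uk k t (jumpMul S p) - jumpMul S (translate t p)‖ ≤ ε / 8 := by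
      refine (hCD k hk0 _ (hUk k hk0) t).trans (le_trans ?_ hk.le)
      refine mul_le_mul_of_nonneg_right (add_le_add ?_ ?_) (Real.sqrt_nonneg _)
      · exact (mul_le_mul_of_nonneg_right (le_abs_self C) (abs_nonneg t)).trans
          (mul_le_mul_of_nonneg_left htT (abs_nonneg C))
      · exact mul_le_mul_of_nonneg_left (le_abs_self D) zero_le_two
    -- Three errors of at most ε/8 each: two from density, unchanged by the unitaries, and one from
    -- the estimate on smooth data.
    have e : (Uk k t - U t) f = Uk k t (f - jumpMul S p) +
        (Uk k t (jumpMul S p) - jumpMul S (translate t p)) - U t (f - jumpMul S p) := by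
      rw [map_sub, map_sub, hUt, sub_apply]
      abel
    change ‖(Uk k t - U t) f‖ ≤ ε / 2
    rw [e]
    refine (norm_sub_le _ _).trans ((add_le_add_left (norm_add_le _ _) _).trans ?_)
    rw [(hUk k hk0).norm_apply, hU.norm_apply]
    linarith
  rw [Real.dist_eq, sub_zero, abs_of_nonneg (Real.iSup_nonneg fun t => norm_nonneg _)]
  exact (Real.iSup_le hle (by positivity)).trans_lt (by linarith)

end Limit

end SingularLimit

end

theorem theorem3 {𝔥 : Type*} [NormedAddCommGroup 𝔥] [InnerProductSpace ℂ 𝔥] [CompleteSpace 𝔥]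
    (E : 𝔥 →L[ℂ] 𝔥) (hE : IsSelfAdjoint E)
    (g : ℝ → ℂ) (hg : ContDiff ℝ ∞ g) (hgc : HasCompactSupport g) (hg1 : ∫ s, g s = 1) :
    -- the operator `S` is well defined and unitary
    IsUnit (SingularLimit.denom E g) ∧
    SingularLimit.scattering E g ∈ unitary (𝔥 →L[ℂ] 𝔥) ∧
    -- the unitary groups `exp(-i t H^{(k)})` and `exp(-i t H)` are well defined
    (∀ k : ℝ, 0 < k → ∃! U : ℝ → (SingularLimit.L2 𝔥 →L[ℂ] SingularLimit.L2 𝔥),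
      SingularLimit.IsUnitaryGroupOf
        (SingularLimit.perturbedHamiltonian E (SingularLimit.scaledL2 g hg hgc k)) U) ∧
    (∃! U : ℝ → (SingularLimit.L2 𝔥 →L[ℂ] SingularLimit.L2 𝔥),
      SingularLimit.IsUnitaryGroupOf
        (SingularLimit.jumpHamiltonian (SingularLimit.scattering E g)) U) ∧
    -- strong convergence, uniformly on bounded time intervals
    ∀ (Uk : ℝ → ℝ → (SingularLimit.L2 𝔥 →L[ℂ] SingularLimit.L2 𝔥))
      (U : ℝ → (SingularLimit.L2 𝔥 →L[ℂ] SingularLimit.L2 𝔥)),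
      (∀ k : ℝ, 0 < k → SingularLimit.IsUnitaryGroupOf
        (SingularLimit.perturbedHamiltonian E (SingularLimit.scaledL2 g hg hgc k)) (Uk k)) →
      SingularLimit.IsUnitaryGroupOf
        (SingularLimit.jumpHamiltonian (SingularLimit.scattering E g)) U →
      ∀ T : ℝ, 0 ≤ T → ∀ f : SingularLimit.L2 𝔥,
        Tendsto (fun k : ℝ => ⨆ t : Set.Icc (0 : ℝ) T, ‖(Uk k t - U t) f‖) atTop (𝓝 0) := by
  refine ⟨SingularLimit.isUnit_denom hE hg.continuous hgc hg1,
    SingularLimit.scattering_mem_unitary hE hg.continuous hgc hg1, fun k _ => ?_, ?_, ?_⟩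
  · obtain ⟨V, hV⟩ := SingularLimit.exists_isUnitaryGroupOf_perturbedHamiltonian hE
      (SingularLimit.scaledL2 g hg hgc k)
    exact ⟨V, hV, fun W hW => hW.unique hV⟩
  · have hV := SingularLimit.isUnitaryGroupOf_jumpHamiltonian
      (SingularLimit.scattering_mem_unitary hE hg.continuous hgc hg1)
    exact ⟨_, hV, fun W hW => hW.unique hV⟩
  · intro Uk U hUk hU T _ f
    exact SingularLimit.tendsto_iSup_norm_sub hE hg hgc hg1 hUk hU T f
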